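/- A *polygon*, possibly with holes and with several components, is a compact set $P\subset\mathbb R^2$ that is the closure of its interior and whose boundary is the union of finitely many nondegenerate line segments (edges), any two of which meet at most in common endpoints. Its vertices are the endpoints of its edges, and its total complexity $n$ is the number of its vertices. Let $\mathcal S$ be the space of maximal line segments of $P$, that is, of all line segments of positive length that lie in the closed region $P$ and are not contained in a larger line segment lying in $P$; give $\mathcal S$ the topology of the Hausdorff metric. Divide $\mathcal S$ into cells: the cell of $s\in\mathcal S$ is the connected component containing $s$ of the set of those $t\in\mathcal S$ that contain exactly the same vertices of $P$ as $s$ (endpoints of segments included). A cell is a *patch*, a *seam* or a *node* according to whether its segments contain no vertex, exactly one vertex, or at least two vertices of $P$. The complexity of $\mathcal S$ is the total number of its patches, seams and nodes. Then $\mathcal S$ has complexity $O(n^2)$: there is an absolute constant $C$ such that for every polygon $P$ of total complexity $n$ the space $\mathcal S$ has finite complexity, at most $C\,n^2$. -/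

import Mathlib

open Set TopologicalSpace

/-- The Euclidean plane. -/
abbrev Plane : Type := EuclideanSpace ℝ (Fin 2)

/-- The closed line segment spanned by an unordered pair of points. -/
def edgeSegment (e : Sym2 Plane) : Set Plane :=
  Sym2.lift ⟨fun a b => segment ℝ a b, fun a b => segment_symm ℝ a b⟩ e

/-- A polygon, possibly with holes and with several components: a compact set that is the closure
of its interior and whose topological boundary is the union of finitely many nondegenerate
segments (the edges), any two of which meet at most in common endpoints. Connectedness is not
required, neither of the region nor of its complement. -/
structure PolygonalRegion where
  /-- The closed region, boundary included. -/
  carrier : Set Plane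
  /-- The corners. -/
  vertices : Finset Plane
  /-- The edges, each given by its two endpoints. -/
  edges : Finset (Sym2 Plane)
  isCompact_carrier : IsCompact carrier
  closure_interior : closure (interior carrier) = carrier
  mem_vertices_iff : ∀ v, v ∈ vertices ↔ ∃ e ∈ edges, v ∈ e
  not_isDiag : ∀ e ∈ edges, ¬ e.IsDiag
  inter_subset : ∀ e ∈ edges, ∀ f ∈ edges, e ≠ f →
    edgeSegment e ∩ edgeSegment f ⊆ {x | x ∈ e ∧ x ∈ f}
  frontier_carrier : frontier carrier = ⋃ e ∈ edges, edgeSegment e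

namespace PolygonalRegion

/-- The total complexity of a polygon: its number of vertices, over all boundary curves. -/
def totalComplexity (P : PolygonalRegion) : ℕ := P.vertices.card

/-- `s` is a closed line segment of positive length contained in the polygon. -/
def IsSegmentIn (P : PolygonalRegion) (s : NonemptyCompacts Plane) : Prop :=
  (∃ a b : Plane, a ≠ b ∧ (s : Set Plane) = segment ℝ a b) ∧ (s : Set Plane) ⊆ P.carrier

/-- The space of maximal line segments: segments in the closed polygon that are not contained in
a larger segment in it. Its topology is that of the Hausdorff metric on nonempty compact sets. -/
def maximalSegments (P : PolygonalRegion) : Set (NonemptyCompacts Plane) :=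
  {s | P.IsSegmentIn s ∧
    ∀ t : NonemptyCompacts Plane, P.IsSegmentIn t → (s : Set Plane) ⊆ t → t = s}

/-- The vertices of the polygon that a segment touches or passes through (endpoints included). -/
def contacts (P : PolygonalRegion) (s : NonemptyCompacts Plane) : Set Plane :=
  {v | v ∈ P.vertices ∧ v ∈ (s : Set Plane)}

/-- The cell of a maximal segment `s`: all maximal segments that can be reached from `s` within a
connected family of maximal segments that contain exactly the same vertices of the polygon. -/
def cell (P : PolygonalRegion) (s : NonemptyCompacts Plane) : Set (NonemptyCompacts Plane) :=
  connectedComponentIn {t | t ∈ P.maximalSegments ∧ P.contacts t = P.contacts s} s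

/-- The two-dimensional cells: the segments move without touching a vertex of the polygon. -/
def patches (P : PolygonalRegion) : Set (Set (NonemptyCompacts Plane)) :=
  {C | ∃ s ∈ P.maximalSegments, (P.contacts s).encard = 0 ∧ C = P.cell s}

/-- The one-dimensional cells: the segments rotate about exactly one vertex of the polygon. -/
def seams (P : PolygonalRegion) : Set (Set (NonemptyCompacts Plane)) :=
  {C | ∃ s ∈ P.maximalSegments, (P.contacts s).encard = 1 ∧ C = P.cell s}

/-- The zero-dimensional cells: the segments through two or more vertices of the polygon. -/
def nodes (P : PolygonalRegion) : Set (Set (NonemptyCompacts Plane)) :=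
  {C | ∃ s ∈ P.maximalSegments, 2 ≤ (P.contacts s).encard ∧ C = P.cell s}

/-- The combinatorial complexity of the space of maximal segments: its total number of cells. It
is `⊤` if there are infinitely many. -/
noncomputable def maximalSegmentComplexity (P : PolygonalRegion) : ℕ∞ :=
  P.nodes.encard + P.seams.encard + P.patches.encard

end PolygonalRegion

/-! Cells of each kind are labelled from a finite set of size O(n²), with no label serving two
cells. Labels suffice because a continuous, connected family of maximal segments with constant
contacts stays in one cell (`cell_eq_cell`).

Nodes: two vertices on a maximal segment determine it.

Seams: the inverse slopes from a vertex `v` to the other vertices cut the non-horizontal directions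
at `v` into at most n+1 intervals. While the direction stays in one interval, the chord through `v`
meets no other vertex and moves continuously, so `v` and the interval determine the seam
(`cell_chord_vertex_eq`). Directions on a cut, and the horizontal one, get labels of their own.

Patches: a chord through a generic interior point `p` is turned about `p` until it first meets a
visible vertex `v` (`exists_isPatchAt`). Such a vertex exists, for otherwise the ends of all chords
through `p` would lie on one edge (`exists_visible_vertex`). The patch is recovered from `v`, the
interval containing the direction of `vp`, the side of `v` on which `p` lies and the sense of
turning: `p` can be slid towards `v`, swung around it and slid out again while the slightly turned
chord stays free of vertices (`IsPatchAt.unique`).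

Continuity rests on one local fact: a segment in the region that touches the boundary in its
relative interior, away from vertices, follows an edge to a vertex. Hence a vertex-free chord is
interior up to its ends, and the ends vary continuously (`continuousAt_reach`). -/

open Filter Topology

/-! ### Plane geometry: cross products and parametrized segments. -/

/-- The two-dimensional cross product. -/
def cross (a b : Plane) : ℝ := a 0 * b 1 - a 1 * b 0

lemma continuous_cross : Continuous fun q : Plane × Plane => cross q.1 q.2 := by
  unfold cross; fun_prop

lemma Continuous.cross {X : Type*} [TopologicalSpace X] {f g : X → Plane} (hf : Continuous f)
    (hg : Continuous g) : Continuous fun x => cross (f x) (g x) :=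
  continuous_cross.comp (hf.prodMk hg)

lemma cross_add_right (a b c : Plane) : cross a (b + c) = cross a b + cross a c := by
  simp [cross]; ring

lemma cross_sub_right (a b c : Plane) : cross a (b - c) = cross a b - cross a c := by
  simp [cross]; ring

lemma cross_smul_right (a b : Plane) (t : ℝ) : cross a (t • b) = t * cross a b := by
  simp [cross]; ring

lemma cross_smul_left (a b : Plane) (t : ℝ) : cross (t • a) b = t * cross a b := by
  simp [cross]; ring

lemma cross_swap (a b : Plane) : cross a b = -cross b a := by
  simp [cross]; ring

@[simp] lemma cross_self_eq_zero (a : Plane) : cross a a = 0 := by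
  simp [cross]; ring

/-- Vectors with vanishing cross product are parallel. -/
lemma exists_smul_of_cross_eq_zero {u d : Plane} (hu : u ≠ 0) (h : cross u d = 0) :
    ∃ t : ℝ, d = t • u := by
  unfold cross at h
  by_cases h0 : u 0 = 0
  · have h1 : u 1 ≠ 0 := by
      intro h1
      apply hu
      ext i; fin_cases i <;> simp [h0, h1]
    refine ⟨d 1 / u 1, ?_⟩
    ext i; fin_cases i
    · rw [h0] at h
      have : d 0 = 0 := by
        rcases mul_eq_zero.1 (by linarith : u 1 * d 0 = 0) with h | h
        · exact absurd h h1
        · exact h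
      simp [h0, this]
    · simp [h1]
  · refine ⟨d 0 / u 0, ?_⟩
    ext i; fin_cases i
    · simp [h0]
    · simp; field_simp; linarith

lemma IsPreconnected.subset_interior_or_disjoint {X : Type*} [TopologicalSpace X] {K S : Set X}
    (hK : IsPreconnected K) (hS : IsClosed S) (h : Disjoint K (frontier S)) :
    K ⊆ interior S ∨ Disjoint K S := by
  by_cases hne : (K ∩ interior S).Nonempty
  · left
    refine hK.subset_left_of_subset_union isOpen_interior hS.isOpen_compl ?_ ?_ hne
    · exact disjoint_left.2 fun x hx hx' => hx' (interior_subset hx)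
    · intro x hx
      by_cases hxS : x ∈ S
      · left
        by_contra hxi
        exact disjoint_left.1 h hx ⟨subset_closure hxS, hxi⟩
      · exact Or.inr hxS
  · right
    rw [disjoint_left]
    intro x hx hxS
    by_cases hxi : x ∈ interior S
    · exact hne ⟨x, hx, hxi⟩
    · exact disjoint_left.1 h hx ⟨subset_closure hxS, hxi⟩

lemma segment_line (p u : Plane) {α β : ℝ} (h : α ≤ β) :
    segment ℝ (p + α • u) (p + β • u) = (fun t : ℝ => p + t • u) '' Icc α β := by
  have := image_segment ℝ (AffineMap.lineMap p (p + u) : ℝ →ᵃ[ℝ] Plane) α β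
  rw [segment_eq_Icc h] at this
  have h2 : ∀ t : ℝ, AffineMap.lineMap p (p + u) t = p + t • u := fun t => by
    simp [AffineMap.lineMap_apply, add_comm]
  simpa only [h2] using this.symm

lemma mem_segment_line {p u x : Plane} {α β : ℝ} (h : α ≤ β) :
    x ∈ segment ℝ (p + α • u) (p + β • u) ↔ ∃ t, α ≤ t ∧ t ≤ β ∧ x = p + t • u := by
  rw [segment_line p u h]
  constructor
  · rintro ⟨t, ht, rfl⟩; exact ⟨t, ht.1, ht.2, rfl⟩
  · rintro ⟨t, h1, h2, rfl⟩; exact ⟨t, ⟨h1, h2⟩, rfl⟩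

/-- A segment through `p` in direction `u`, as a parameter interval. -/
lemma exists_params_of_segment {a b p u : Plane} (hp : p ∈ segment ℝ a b) (hu : u ≠ 0)
    (h : cross u (b - a) = 0) :
    ∃ α β : ℝ, α ≤ 0 ∧ 0 ≤ β ∧ segment ℝ a b = segment ℝ (p + α • u) (p + β • u) := by
  obtain ⟨c, hc⟩ := exists_smul_of_cross_eq_zero hu h
  rw [segment_eq_image'] at hp
  obtain ⟨θ, ⟨h0, h1⟩, rfl⟩ := hp
  have ea : a = (a + θ • (b - a)) + (-θ * c) • u := by rw [hc]; module
  have eb : b = (a + θ • (b - a)) + ((1 - θ) * c) • u := by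
    rw [mul_smul, ← hc]; module
  rcases le_total 0 c with hc0 | hc0
  · refine ⟨-θ * c, (1 - θ) * c, by nlinarith, by nlinarith, ?_⟩
    rw [← ea, ← eb]
  · refine ⟨(1 - θ) * c, -θ * c, by nlinarith, by nlinarith, ?_⟩
    rw [← ea, ← eb, segment_symm]

/-- The segment between two points as a nonempty compact set. -/
noncomputable def segmentCompacts (a b : Plane) : NonemptyCompacts Plane :=
  (⟨⟨Icc (0 : ℝ) 1, isCompact_Icc⟩, by simp⟩ : NonemptyCompacts ℝ).map
    (fun t => a + t • (b - a)) (by fun_prop)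

@[simp] lemma coe_segmentCompacts (a b : Plane) :
    (segmentCompacts a b : Set Plane) = segment ℝ a b := by
  rw [segment_eq_image']; rfl

/-- Reduces Hausdorff continuity of a family of segments to continuity of the endpoints. -/
lemma continuous_segmentCompacts :
    Continuous fun q : Plane × Plane => segmentCompacts q.1 q.2 :=
  Continuous.nonemptyCompacts_map' (f := fun _ : Plane × Plane =>
    (⟨⟨Icc (0 : ℝ) 1, isCompact_Icc⟩, by simp⟩ : NonemptyCompacts ℝ))
    (g := fun (q : Plane × Plane) t => q.1 + t • (q.2 - q.1)) continuous_const
    (by simp only [Function.uncurry_def]; fun_prop)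

lemma edgeSegment_mk (a b : Plane) : edgeSegment s(a, b) = segment ℝ a b := rfl

lemma isClosed_edgeSegment (e : Sym2 Plane) : IsClosed (edgeSegment e) := by
  induction e with
  | _ a b =>
    rw [edgeSegment_mk, ← coe_segmentCompacts]
    exact (segmentCompacts a b).isCompact.isClosed

lemma convex_edgeSegment (e : Sym2 Plane) : Convex ℝ (edgeSegment e) := by
  induction e with
  | _ a b => exact convex_segment a b

/-! ### The region near its boundary. -/

namespace PolygonalRegion

variable (P : PolygonalRegion)

lemma isClosed_carrier : IsClosed P.carrier := P.isCompact_carrier.isClosed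

lemma mem_interior_or_mem_frontier {x : Plane} (hx : x ∈ P.carrier) :
    x ∈ interior P.carrier ∨ x ∈ frontier P.carrier := by
  by_cases h : x ∈ interior P.carrier
  · exact Or.inl h
  · exact Or.inr ⟨subset_closure hx, h⟩

lemma exists_edge_of_mem_frontier {x : Plane} (hx : x ∈ frontier P.carrier) :
    ∃ e ∈ P.edges, x ∈ edgeSegment e := by
  rw [P.frontier_carrier] at hx
  simpa using hx

lemma edgeSegment_subset_frontier {e : Sym2 Plane} (he : e ∈ P.edges) :
    edgeSegment e ⊆ frontier P.carrier := by
  rw [P.frontier_carrier]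
  exact subset_biUnion_of_mem (u := fun e => edgeSegment e) he

lemma edgeSegment_subset_carrier {e : Sym2 Plane} (he : e ∈ P.edges) :
    edgeSegment e ⊆ P.carrier :=
  (P.edgeSegment_subset_frontier he).trans P.isClosed_carrier.frontier_subset

/-- Near a point, the frontier consists of the edges through that point. -/
lemma eventually_frontier (x : Plane) : ∀ᶠ z in 𝓝 x, z ∈ frontier P.carrier →
    ∃ e ∈ P.edges, x ∈ edgeSegment e ∧ z ∈ edgeSegment e := by
  have : ∀ᶠ z in 𝓝 x, ∀ e ∈ P.edges, x ∉ edgeSegment e → z ∉ edgeSegment e := by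
    rw [Filter.eventually_all_finset]
    intro e _
    by_cases hx : x ∈ edgeSegment e
    · exact Eventually.of_forall fun z h => absurd hx h
    · filter_upwards [(isClosed_edgeSegment e).isOpen_compl.mem_nhds hx] with z hz _ using hz
  filter_upwards [this] with z hz hzf
  obtain ⟨e, he, hze⟩ := P.exists_edge_of_mem_frontier hzf
  refine ⟨e, he, ?_, hze⟩
  by_contra h
  exact hz e he h hze

/-- A segment in the region whose relative interior touches the boundary away from the vertices
runs along an edge there, hence sees a vertex ahead. -/
lemma exists_vertex_of_not_mem_interior {x u : Plane} (hu : u ≠ 0) {ε : ℝ} (hε : 0 < ε)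
    (hx : ∀ t : ℝ, |t| ≤ ε → x + t • u ∈ P.carrier) (hxi : x ∉ interior P.carrier)
    (hxv : x ∉ P.vertices) :
    ∃ w ∈ P.vertices, ∃ c : ℝ, 0 < c ∧ w = x + c • u ∧ segment ℝ x w ⊆ P.carrier := by
  have hxP : x ∈ P.carrier := by simpa using hx 0 (by simpa using hε.le)
  have hxf : x ∈ frontier P.carrier := (P.mem_interior_or_mem_frontier hxP).resolve_left hxi
  obtain ⟨e, he, hxe⟩ := P.exists_edge_of_mem_frontier hxf
  have huniq : ∀ f ∈ P.edges, x ∈ edgeSegment f → f = e := by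
    intro f hf hxf'
    by_contra hne
    have := P.inter_subset f hf e he hne ⟨hxf', hxe⟩
    exact hxv ((P.mem_vertices_iff x).2 ⟨e, he, this.2⟩)
  have hnear : ∀ᶠ z in 𝓝 x, z ∈ frontier P.carrier → z ∈ edgeSegment e := by
    filter_upwards [P.eventually_frontier x] with z hz hzf
    obtain ⟨f, hf, hxf', hzf'⟩ := hz hzf
    rwa [huniq f hf hxf'] at hzf'
  obtain ⟨r, hr, hball⟩ := Metric.eventually_nhds_iff_ball.1 hnear
  induction e with
  | _ a b =>
  have hav : a ∈ P.vertices := (P.mem_vertices_iff a).2 ⟨_, he, by simp⟩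
  have hbv : b ∈ P.vertices := (P.mem_vertices_iff b).2 ⟨_, he, by simp⟩
  have hab : a ≠ b := fun h => P.not_isDiag _ he (by simpa using h)
  rw [edgeSegment_mk] at hxe
  by_cases hcr : cross (b - a) u = 0
  · obtain ⟨α, β, hα, hβ, hs⟩ := exists_params_of_segment hxe hu (by rw [cross_swap, hcr, neg_zero])
    have key : ∀ w ∈ P.vertices, w ∈ segment ℝ a b → segment ℝ x w ⊆ P.carrier := by
      intro w _ hw
      refine ((convex_segment a b).segment_subset hxe hw).trans ?_
      exact P.edgeSegment_subset_carrier he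
    obtain ⟨ta, ha1, ha2, ha⟩ := (mem_segment_line (hα.trans hβ)).1 (hs ▸ left_mem_segment ℝ a b)
    obtain ⟨tb, hb1, hb2, hb⟩ := (mem_segment_line (hα.trans hβ)).1 (hs ▸ right_mem_segment ℝ a b)
    by_cases h1 : 0 < ta
    · exact ⟨a, hav, ta, h1, ha, key a hav (left_mem_segment ℝ a b)⟩
    by_cases h2 : 0 < tb
    · exact ⟨b, hbv, tb, h2, hb, key b hbv (right_mem_segment ℝ a b)⟩
    -- The point `x` is a convex combination of the two ends; if neither lies ahead, one of them
    -- must equal `x`, which is not a vertex.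
    exfalso
    push Not at h1 h2
    rw [segment_eq_image'] at hxe
    obtain ⟨θ, ⟨h0, h1'⟩, hθ⟩ := hxe
    have hz : ((1 - θ) * ta + θ * tb) • u = 0 := by
      have : x = x + ((1 - θ) * ta + θ * tb) • u := by
        calc x = a + θ • (b - a) := hθ.symm
          _ = (1 - θ) • a + θ • b := by module
          _ = (1 - θ) • (x + ta • u) + θ • (x + tb • u) := by rw [← ha, ← hb]
          _ = _ := by module
      simpa using this
    have hz' := (smul_eq_zero.1 hz).resolve_right hu
    have : ta = 0 ∨ tb = 0 := by
      by_contra hne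
      push Not at hne
      have h3 := lt_of_le_of_ne h1 hne.1
      have h4 := lt_of_le_of_ne h2 hne.2
      have h5 : (1 - θ) * ta ≤ 0 := by nlinarith
      have h6 : θ * tb ≤ 0 := by nlinarith
      have h7 : (1 - θ) * ta = 0 := by linarith
      have h8 : θ * tb = 0 := by linarith
      rcases mul_eq_zero.1 h7 with h | h
      · rcases mul_eq_zero.1 h8 with h' | h'
        · linarith
        · exact hne.2 h'
      · exact hne.1 h
    rcases this with h | h
    · rw [h, zero_smul, add_zero] at ha; exact hxv (ha ▸ hav)
    · rw [h, zero_smul, add_zero] at hb; exact hxv (hb ▸ hbv)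
  -- The edge is transversal to `u`. Each open half of a small disc cut by the edge line avoids the
  -- frontier and contains points of the segment, so both halves lie in the region and `x` is
  -- interior.
  · exfalso
    have hline : ∀ z ∈ segment ℝ a b, cross (b - a) (z - x) = 0 := by
      intro z hz
      rw [segment_eq_image'] at hz hxe
      obtain ⟨s, -, rfl⟩ := hz
      obtain ⟨t, -, rfl⟩ := hxe
      have : a + s • (b - a) - (a + t • (b - a)) = (s - t) • (b - a) := by module
      simp [this, cross_smul_right]
    have hhalf : ∀ σ : ℝ, σ ≠ 0 → {z | z ∈ Metric.ball x r ∧ 0 < σ * cross (b - a) (z - x)} ⊆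
        P.carrier := by
      intro σ hσ
      set H := {z | z ∈ Metric.ball x r ∧ 0 < σ * cross (b - a) (z - x)} with hH
      have hconv : Convex ℝ H := by
        intro y hy z hz s t hs ht hst
        refine ⟨convex_ball x r hy.1 hz.1 hs ht hst, ?_⟩
        have : s • y + t • z - x = s • (y - x) + t • (z - x) := by
          have : x = (s + t) • x := by rw [hst, one_smul]
          nth_rewrite 1 [this]; module
        rw [this, cross_add_right, cross_smul_right, cross_smul_right]
        have h1 := hy.2
        have h2 := hz.2
        rcases hs.eq_or_lt with rfl | hs
        · have : t = 1 := by linarith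
          simpa [this] using h2
        · nlinarith [mul_pos hs h1, mul_nonneg ht h2.le]
      have hdisj : Disjoint H (frontier P.carrier) := by
        rw [disjoint_left]
        intro z hz hzf
        have := hline z (hball z hz.1 hzf)
        have h2 := hz.2
        rw [this] at h2; simp at h2
      rcases hconv.isPreconnected.subset_interior_or_disjoint P.isClosed_carrier hdisj with h | h
      · exact h.trans interior_subset
      · exfalso
        -- The factor `σ * cross (b - a) u` selects the half of the segment lying in `H`: the
        -- defining quantity becomes `t` times its square.
        have htend : Tendsto (fun t : ℝ => x + (t * (σ * cross (b - a) u)) • u) (𝓝[>] 0) (𝓝 x) := by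
          have : Continuous (fun t : ℝ => x + (t * (σ * cross (b - a) u)) • u) := by fun_prop
          have := this.tendsto 0
          simp only [zero_mul, zero_smul, add_zero] at this
          exact this.mono_left nhdsWithin_le_nhds
        have htend2 : Tendsto (fun t : ℝ => t * (σ * cross (b - a) u)) (𝓝[>] 0) (𝓝 0) := by
          have : Continuous (fun t : ℝ => t * (σ * cross (b - a) u)) := by fun_prop
          have := this.tendsto 0
          simp only [zero_mul] at this
          exact this.mono_left nhdsWithin_le_nhds
        obtain ⟨t, h1, h2, h3⟩ := ((htend.eventually (Metric.ball_mem_nhds x hr)).and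
          ((htend2.eventually (Metric.closedBall_mem_nhds 0 hε)).and self_mem_nhdsWithin)).exists
        have hmem : x + (t * (σ * cross (b - a) u)) • u ∈ H := by
          refine ⟨h1, ?_⟩
          rw [add_sub_cancel_left, cross_smul_right]
          have h3' : (0:ℝ) < t := h3
          have : 0 < (σ * cross (b - a) u) ^ 2 := by positivity
          nlinarith [mul_pos h3' this]
        refine disjoint_left.1 h hmem (hx _ ?_)
        simpa [Metric.mem_closedBall, Real.dist_eq] using h2
    have hsub : Metric.ball x r ⊆ P.carrier := by
      intro z hz
      rcases lt_trichotomy (cross (b - a) (z - x)) 0 with h | h | h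
      · exact hhalf (-1) (by norm_num) ⟨hz, by linarith⟩
      -- Points on the dividing line are limits of points of one half, and the region is closed.
      · have htend : Tendsto (fun t : ℝ => z + (t * cross (b - a) u) • u) (𝓝[>] 0) (𝓝 z) := by
          have : Continuous (fun t : ℝ => z + (t * cross (b - a) u) • u) := by fun_prop
          have := this.tendsto 0
          simp only [zero_mul, zero_smul, add_zero] at this
          exact this.mono_left nhdsWithin_le_nhds
        refine P.isClosed_carrier.mem_of_tendsto htend ?_
        filter_upwards [htend (Metric.isOpen_ball.mem_nhds hz), self_mem_nhdsWithin] with t ht ht0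
        refine hhalf 1 one_ne_zero ⟨ht, ?_⟩
        have : z + (t * cross (b - a) u) • u - x = (z - x) + (t * cross (b - a) u) • u := by module
        rw [this, cross_add_right, cross_smul_right, h]
        have h3' : (0:ℝ) < t := ht0
        have : 0 < (cross (b - a) u) ^ 2 := by positivity
        nlinarith [mul_pos h3' this]
      · exact hhalf 1 one_ne_zero ⟨hz, by linarith⟩
    exact hxi (mem_interior.2 ⟨_, hsub, Metric.isOpen_ball, Metric.mem_ball_self hr⟩)

end PolygonalRegion

/-! ### Reach in a direction, and chords. -/

namespace PolygonalRegion

variable (P : PolygonalRegion)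

/-- How far one can go from `p` in direction `u` without leaving the region. -/
noncomputable def reach (p u : Plane) : ℝ :=
  sSup {t : ℝ | 0 ≤ t ∧ ∀ s ∈ Icc 0 t, p + s • u ∈ P.carrier}

variable {P}

lemma reach_nonneg (p u : Plane) : 0 ≤ P.reach p u :=
  Real.sSup_nonneg fun _ ht => ht.1

lemma bddAbove_reach (p : Plane) {u : Plane} (hu : u ≠ 0) :
    BddAbove {t : ℝ | 0 ≤ t ∧ ∀ s ∈ Icc 0 t, p + s • u ∈ P.carrier} := by
  obtain ⟨R, hR⟩ := P.isCompact_carrier.isBounded.exists_norm_le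
  have hu' : 0 < ‖u‖ := norm_pos_iff.2 hu
  refine ⟨(R + ‖p‖) / ‖u‖, fun t ht => ?_⟩
  have h1 := hR _ (ht.2 t ⟨ht.1, le_rfl⟩)
  rw [le_div_iff₀ hu']
  calc t * ‖u‖ = ‖t • u‖ := by rw [norm_smul, Real.norm_of_nonneg ht.1]
    _ = ‖(p + t • u) - p‖ := by rw [add_sub_cancel_left]
    _ ≤ ‖p + t • u‖ + ‖p‖ := norm_sub_le _ _
    _ ≤ _ := by linarith

lemma le_reach {p u : Plane} (hu : u ≠ 0) {t : ℝ} (ht : 0 ≤ t)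
    (h : ∀ s ∈ Icc 0 t, p + s • u ∈ P.carrier) : t ≤ P.reach p u :=
  le_csSup (bddAbove_reach p hu) ⟨ht, h⟩

lemma mem_of_lt_reach {p u : Plane} {t : ℝ} (ht : 0 ≤ t) (h : t < P.reach p u) :
    p + t • u ∈ P.carrier := by
  -- For `p` outside the region the set is empty and its supremum is 0 by default, which `0 ≤ t <
  -- reach` excludes.
  have hne : {t : ℝ | 0 ≤ t ∧ ∀ s ∈ Icc 0 t, p + s • u ∈ P.carrier}.Nonempty := by
    by_contra hne
    rw [not_nonempty_iff_eq_empty] at hne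
    rw [reach, hne, Real.sSup_empty] at h
    linarith
  obtain ⟨t', ht', hlt⟩ := exists_lt_of_lt_csSup hne h
  exact ht'.2 t ⟨ht, hlt.le⟩

lemma mem_of_le_reach {p u : Plane} (hp : p ∈ P.carrier) {t : ℝ} (ht : 0 ≤ t)
    (h : t ≤ P.reach p u) : p + t • u ∈ P.carrier := by
  rcases ht.eq_or_lt with rfl | ht0
  · simpa using hp
  rcases h.lt_or_eq with h | h
  · exact mem_of_lt_reach ht h
  have hc : Continuous fun s : ℝ => p + s • u := by fun_prop
  refine P.isClosed_carrier.mem_of_tendsto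
    ((hc.tendsto t).mono_left (nhdsWithin_le_nhds (s := Iio t))) ?_
  filter_upwards [self_mem_nhdsWithin, mem_nhdsWithin_of_mem_nhds (lt_mem_nhds ht0)] with s h1 h2
  exact mem_of_lt_reach (le_of_lt h2) (h ▸ h1)

lemma exists_not_mem_of_reach_lt {p u : Plane} (hp : p ∈ P.carrier) (hu : u ≠ 0) {t : ℝ}
    (h : P.reach p u < t) : ∃ s, P.reach p u < s ∧ s < t ∧ p + s • u ∉ P.carrier := by
  by_contra! hcon
  obtain ⟨t', h1, h2⟩ := exists_between h
  have := le_reach (P := P) (p := p) hu ((reach_nonneg p u).trans h1.le) (fun s hs => by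
    rcases le_or_gt s (P.reach p u) with h3 | h3
    · exact mem_of_le_reach hp hs.1 h3
    · exact hcon s h3 (hs.2.trans_lt h2))
  linarith

lemma reach_pos {p : Plane} (hp : p ∈ interior P.carrier) {u : Plane} (hu : u ≠ 0) :
    0 < P.reach p u := by
  have hc : Continuous fun s : ℝ => p + s • u := by fun_prop
  have : ∀ᶠ s in 𝓝 (0 : ℝ), p + s • u ∈ interior P.carrier :=
    hc.tendsto 0 |>.eventually (isOpen_interior.mem_nhds (by simpa using hp))
  obtain ⟨ε, hε, h⟩ := Metric.eventually_nhds_iff_ball.1 this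
  have h2 : ε / 2 ≤ P.reach p u := le_reach hu (by positivity) fun s hs => interior_subset <| h s <| by
    rw [mem_ball_zero_iff, Real.norm_of_nonneg hs.1]
    linarith [hs.2]
  linarith

/-- The chord of direction `u` through `p` is cut off at the interior of an edge, unless it runs
into a vertex; before that it stays in the interior. -/
lemma mem_interior_of_lt_reach {p u : Plane} (hp : p ∈ interior P.carrier) (hu : u ≠ 0)
    (hv : ∀ w ∈ P.vertices, ∀ c : ℝ, 0 < c → w = p + c • u → ¬ segment ℝ p w ⊆ P.carrier)
    {t : ℝ} (ht : 0 ≤ t) (h : t < P.reach p u) : p + t • u ∈ interior P.carrier := by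
  rcases ht.eq_or_lt with rfl | ht0
  · simpa using hp
  have hpP := interior_subset hp
  have hseg : ∀ c, 0 ≤ c → c ≤ P.reach p u → segment ℝ p (p + c • u) ⊆ P.carrier := by
    intro c hc0 hc x hx
    have : p = p + (0 : ℝ) • u := by simp
    rw [this, add_assoc, ← add_smul, zero_add, mem_segment_line hc0] at hx
    obtain ⟨s, hs0, hs1, rfl⟩ := hx
    exact mem_of_le_reach hpP hs0 (hs1.trans hc)
  -- A boundary point before the end would yield a vertex further along the ray, visible from `p` by
  -- joining the two pieces.
  by_contra hxi
  obtain ⟨w, hw, c, hc, hwc, hws⟩ := P.exists_vertex_of_not_mem_interior (x := p + t • u) hu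
    (ε := min t (P.reach p u - t)) (lt_min ht0 (by linarith)) (fun s hs => by
      have h1 := (abs_le.1 (hs.trans (min_le_left _ _)))
      have h2 := (abs_le.1 (hs.trans (min_le_right _ _)))
      rw [add_assoc, ← add_smul]
      exact mem_of_le_reach hpP (by linarith) (by linarith)) hxi
    (fun hxv => hv _ hxv t ht0 rfl (hseg t ht h.le))
  have hw' : w = p + (t + c) • u := by rw [hwc, add_assoc, add_smul]
  refine hv w hw (t + c) (by linarith) hw' ?_
  intro x hx
  have : p = p + (0 : ℝ) • u := by simp
  rw [hw', this, add_assoc, ← add_smul, zero_add, mem_segment_line (by linarith)] at hx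
  obtain ⟨s, hs0, hs1, rfl⟩ := hx
  rcases le_total s t with hst | hst
  · exact mem_of_le_reach hpP hs0 (hst.trans h.le)
  · apply hws
    have e1 : p + s • u = (p + t • u) + (s - t) • u := by module
    have e2 : segment ℝ (p + t • u) w =
        segment ℝ ((p + t • u) + (0 : ℝ) • u) ((p + t • u) + c • u) := by rw [hwc]; simp
    rw [e2, mem_segment_line hc.le]
    exact ⟨s - t, by linarith, by linarith, e1⟩

/-- Lower bound: any shorter piece of the ray is compact and interior, so nearby rays keep it. Upper
bound: just past the end there is a point of the open complement; this half does not need `hv`. -/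
lemma continuousAt_reach {p u : Plane} (hp : p ∈ interior P.carrier) (hu : u ≠ 0)
    (hv : ∀ w ∈ P.vertices, ∀ c : ℝ, 0 < c → w = p + c • u → ¬ segment ℝ p w ⊆ P.carrier) :
    ContinuousAt (fun q : Plane × Plane => P.reach q.1 q.2) (p, u) := by
  have hne : ∀ᶠ q : Plane × Plane in 𝓝 (p, u), q.2 ≠ 0 :=
    continuous_snd.tendsto (p, u) |>.eventually (isOpen_ne.mem_nhds hu)
  rw [ContinuousAt, tendsto_order]
  constructor
  · intro a ha
    rcases lt_or_ge a 0 with ha0 | ha0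
    · exact Eventually.of_forall fun q => ha0.trans_le (reach_nonneg _ _)
    obtain ⟨b, hab, hb⟩ := exists_between ha
    have hcpt := (isCompact_Icc (a := (0 : ℝ)) (b := b)).eventually_forall_of_forall_eventually
      (x₀ := (p, u)) (P := fun (q : Plane × Plane) s => q.1 + s • q.2 ∈ interior P.carrier)
      (fun s hs => by
        have hc : Continuous fun z : (Plane × Plane) × ℝ => z.1.1 + z.2 • z.1.2 := by fun_prop
        exact (hc.tendsto ((p, u), s)).eventually (isOpen_interior.mem_nhds
          (mem_interior_of_lt_reach hp hu hv hs.1 (hs.2.trans_lt hb))))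
    filter_upwards [hcpt, hne] with q hq hq0
    exact hab.trans_le (le_reach hq0 (ha0.trans hab.le) fun s hs => interior_subset (hq s hs))
  · intro a ha
    obtain ⟨s, h1, h2, h3⟩ := exists_not_mem_of_reach_lt (interior_subset hp) hu ha
    have hc : Continuous fun q : Plane × Plane => q.1 + s • q.2 := by fun_prop
    filter_upwards [(hc.tendsto (p, u)).eventually (P.isClosed_carrier.isOpen_compl.mem_nhds h3)]
      with q hq
    refine lt_of_le_of_lt ?_ h2
    by_contra! hlt
    exact hq (mem_of_lt_reach ((reach_nonneg p u).trans h1.le) hlt)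

variable (P) in
/-- The maximal segment in direction `u` through a point `p` of the region. -/
noncomputable def chord (p u : Plane) : NonemptyCompacts Plane :=
  segmentCompacts (p + (-P.reach p (-u)) • u) (p + P.reach p u • u)

lemma mem_chord_iff_exists {p u x : Plane} : x ∈ (P.chord p u : Set Plane) ↔
    ∃ t, -P.reach p (-u) ≤ t ∧ t ≤ P.reach p u ∧ x = p + t • u := by
  rw [chord, coe_segmentCompacts, mem_segment_line]
  linarith [reach_nonneg (P := P) p u, reach_nonneg (P := P) p (-u)]

lemma self_mem_chord (p u : Plane) : p ∈ (P.chord p u : Set Plane) :=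
  mem_chord_iff_exists.2 ⟨0, by linarith [reach_nonneg (P := P) p (-u)], reach_nonneg _ _, by simp⟩

lemma chord_subset {p : Plane} (hp : p ∈ P.carrier) (u : Plane) :
    (P.chord p u : Set Plane) ⊆ P.carrier := by
  intro x hx
  obtain ⟨t, h1, h2, rfl⟩ := mem_chord_iff_exists.1 hx
  rcases le_total 0 t with h | h
  · exact mem_of_le_reach hp h h2
  · have : p + t • u = p + (-t) • (-u) := by module
    rw [this]
    exact mem_of_le_reach hp (by linarith) (by linarith)

lemma segment_subset_chord {a b p u : Plane} (hu : u ≠ 0) (hp : p ∈ segment ℝ a b)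
    (h : cross u (b - a) = 0) (hs : segment ℝ a b ⊆ P.carrier) :
    segment ℝ a b ⊆ P.chord p u := by
  obtain ⟨α, β, hα, hβ, he⟩ := exists_params_of_segment hp hu h
  have hmem : ∀ t, α ≤ t → t ≤ β → p + t • u ∈ P.carrier := fun t h1 h2 =>
    hs (he ▸ (mem_segment_line (hα.trans hβ)).2 ⟨t, h1, h2, rfl⟩)
  have h1 : β ≤ P.reach p u := le_reach hu hβ fun s hs => hmem s (hα.trans hs.1) hs.2
  have h2 : -α ≤ P.reach p (-u) := le_reach (neg_ne_zero.2 hu) (by linarith) fun s hs => by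
    have : p + s • (-u) = p + (-s) • u := by module
    rw [this]
    exact hmem _ (by linarith [hs.2]) (by linarith [hs.1])
  intro x hx
  rw [he, mem_segment_line (hα.trans hβ)] at hx
  obtain ⟨t, ht1, ht2, rfl⟩ := hx
  exact mem_chord_iff_exists.2 ⟨t, by linarith, by linarith, rfl⟩

lemma cross_sub_eq_zero_of_mem_chord {p u x : Plane} (h : x ∈ (P.chord p u : Set Plane)) :
    cross u (x - p) = 0 := by
  obtain ⟨t, -, -, rfl⟩ := mem_chord_iff_exists.1 h
  simp [cross_smul_right]

lemma mem_chord_iff {p u w : Plane} (hp : p ∈ P.carrier) (hu : u ≠ 0) :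
    w ∈ (P.chord p u : Set Plane) ↔ cross u (w - p) = 0 ∧ segment ℝ p w ⊆ P.carrier := by
  constructor
  · intro h
    refine ⟨cross_sub_eq_zero_of_mem_chord h, ?_⟩
    have hc : Convex ℝ (P.chord p u : Set Plane) := by
      rw [chord, coe_segmentCompacts]; exact convex_segment _ _
    exact (hc.segment_subset (self_mem_chord p u) h).trans (chord_subset hp u)
  · rintro ⟨h1, h2⟩
    exact segment_subset_chord hu (left_mem_segment ℝ p w) h1 h2 (right_mem_segment ℝ p w)

lemma cross_sub_eq_zero_of_subset_chord {p u a b : Plane}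
    (ha : a ∈ (P.chord p u : Set Plane)) (hb : b ∈ (P.chord p u : Set Plane)) :
    cross u (b - a) = 0 := by
  have h1 := cross_sub_eq_zero_of_mem_chord ha
  have h2 := cross_sub_eq_zero_of_mem_chord hb
  rw [cross_sub_right] at h1 h2 ⊢
  linarith

/-- A segment containing a nondegenerate chord is parallel to `u` and passes through `p`, so the
reaches bound it. The last hypothesis excludes a chord that is a single point. -/
lemma chord_mem_maximalSegments {p u : Plane} (hp : p ∈ P.carrier) (hu : u ≠ 0)
    (h : 0 < P.reach p u ∨ 0 < P.reach p (-u)) : P.chord p u ∈ P.maximalSegments := by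
  set A := p + (-P.reach p (-u)) • u with hA
  set B := p + P.reach p u • u with hB
  have hr1 := reach_nonneg (P := P) p u
  have hr2 := reach_nonneg (P := P) p (-u)
  have hpos : 0 < P.reach p u + P.reach p (-u) := by rcases h with h | h <;> linarith
  have hBA : B - A = (P.reach p u + P.reach p (-u)) • u := by rw [hA, hB]; module
  have hne : A ≠ B := by
    intro h
    rw [h, sub_self] at hBA
    exact (smul_ne_zero hpos.ne' hu) hBA.symm
  have hAm : A ∈ (P.chord p u : Set Plane) := by
    rw [chord, coe_segmentCompacts]; exact left_mem_segment ℝ _ _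
  have hBm : B ∈ (P.chord p u : Set Plane) := by
    rw [chord, coe_segmentCompacts]; exact right_mem_segment ℝ _ _
  refine ⟨⟨⟨A, B, hne, by rw [chord, coe_segmentCompacts]⟩, chord_subset hp u⟩, ?_⟩
  rintro t ⟨⟨a, b, hab, ht⟩, htP⟩ hsub
  apply SetLike.coe_injective
  refine Subset.antisymm ?_ hsub
  have hAt := hsub hAm
  have hBt := hsub hBm
  have hpt := hsub (self_mem_chord p u)
  rw [ht] at hAt hBt htP hpt ⊢
  refine segment_subset_chord hu hpt ?_ htP
  obtain ⟨α, β, hα, hβ, he⟩ := exists_params_of_segment (u := b - a) hAt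
    (sub_ne_zero.2 hab.symm) (cross_self_eq_zero _)
  rw [he, mem_segment_line (hα.trans hβ)] at hBt
  obtain ⟨c, -, -, hc⟩ := hBt
  have : B - A = c • (b - a) := by rw [hc]; module
  rw [hBA] at this
  have h3 : cross (b - a) ((P.reach p u + P.reach p (-u)) • u) = 0 := by
    rw [this, cross_smul_right, cross_self_eq_zero, mul_zero]
  rw [cross_smul_right] at h3
  rw [cross_swap, (mul_eq_zero.1 h3).resolve_left hpos.ne', neg_zero]

lemma eq_chord_of_mem_maximalSegments {s : NonemptyCompacts Plane} (hs : s ∈ P.maximalSegments)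
    {a b p u : Plane} (hab : a ≠ b) (hse : (s : Set Plane) = segment ℝ a b)
    (hp : p ∈ (s : Set Plane)) (hu : u ≠ 0) (h : cross u (b - a) = 0) : s = P.chord p u := by
  have hpP : p ∈ P.carrier := hs.1.2 hp
  have hsub : (s : Set Plane) ⊆ P.chord p u := by
    rw [hse] at hp ⊢
    exact segment_subset_chord hu hp h (hse ▸ hs.1.2)
  refine (hs.2 _ ⟨⟨p + (-P.reach p (-u)) • u, p + P.reach p u • u, ?_, by
    rw [chord, coe_segmentCompacts]⟩, chord_subset hpP u⟩ hsub).symm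
  intro heq
  have h1 : (P.chord p u : Set Plane) = {p + P.reach p u • u} := by
    rw [chord, coe_segmentCompacts, heq, segment_same]
  rw [h1, hse] at hsub
  exact hab ((hsub (left_mem_segment ℝ a b)).trans (hsub (right_mem_segment ℝ a b)).symm)

/-- A maximal segment is the chord through any of its points. -/
lemma chord_eq_chord {p q u u' : Plane} (hs : P.chord p u ∈ P.maximalSegments) (hu : u ≠ 0)
    (hu' : u' ≠ 0) (h : cross u u' = 0) (hq : q ∈ (P.chord p u : Set Plane)) :
    P.chord p u = P.chord q u' := by
  obtain ⟨a, b, hab, hse⟩ := hs.1.1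
  refine eq_chord_of_mem_maximalSegments hs hab hse hq hu' ?_
  have := cross_sub_eq_zero_of_subset_chord (P := P) (p := p) (u := u)
    (hse ▸ left_mem_segment ℝ a b) (hse ▸ right_mem_segment ℝ a b)
  obtain ⟨c, hc⟩ := exists_smul_of_cross_eq_zero hu this
  rw [hc, cross_smul_right, cross_swap, h]; simp

/-- The only tool for identifying cells: the image of `T` is a connected family with constant
contacts. -/
lemma cell_eq_cell {X : Type*} [TopologicalSpace X] {T : Set X} (hT : IsPreconnected T)
    {Φ : X → NonemptyCompacts Plane} (hΦ : ContinuousOn Φ T) {c : Set Plane}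
    (h : ∀ x ∈ T, Φ x ∈ P.maximalSegments ∧ P.contacts (Φ x) = c) {x y : X} (hx : x ∈ T)
    (hy : y ∈ T) : P.cell (Φ x) = P.cell (Φ y) := by
  rw [cell, cell, (h x hx).2, (h y hy).2]
  apply connectedComponentIn_eq
  refine (hT.image Φ hΦ).subset_connectedComponentIn (mem_image_of_mem Φ hx) ?_
    (mem_image_of_mem Φ hy)
  rintro _ ⟨z, hz, rfl⟩
  exact h z hz

/-! ### Chords that contain no vertex. -/

variable (P) in
/-- The pairs of an interior point and a direction whose chord contains no vertex. -/
def vertexFree : Set (Plane × Plane) :=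
  {q | q.1 ∈ interior P.carrier ∧ q.2 ≠ 0 ∧
    ∀ w ∈ P.vertices, ¬ (cross q.2 (w - q.1) = 0 ∧ segment ℝ q.1 w ⊆ P.carrier)}

lemma isClosed_visible (w : Plane) : IsClosed {p : Plane | segment ℝ p w ⊆ P.carrier} := by
  have : {p : Plane | segment ℝ p w ⊆ P.carrier} =
      ⋂ θ ∈ Icc (0 : ℝ) 1, {p | p + θ • (w - p) ∈ P.carrier} := by
    ext p
    simp only [segment_eq_image', mem_ofPred_eq, image_subset_iff, mem_iInter]
    rfl
  rw [this]
  refine isClosed_biInter fun θ _ => P.isClosed_carrier.preimage (by fun_prop)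

/-- Collinearity with `w` and visibility of `w` are both closed conditions, visibility because the
region is closed. -/
lemma isOpen_not_through (w : Plane) :
    IsOpen {q : Plane × Plane | ¬ (cross q.2 (w - q.1) = 0 ∧ segment ℝ q.1 w ⊆ P.carrier)} := by
  have h1 : IsClosed {q : Plane × Plane | cross q.2 (w - q.1) = 0} :=
    isClosed_eq (continuous_snd.cross (by fun_prop)) continuous_const
  have h2 : IsClosed {q : Plane × Plane | segment ℝ q.1 w ⊆ P.carrier} :=
    (isClosed_visible w).preimage continuous_fst
  exact (h1.inter h2).isOpen_compl

lemma isOpen_vertexFree : IsOpen P.vertexFree := by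
  have : P.vertexFree = {q | q.1 ∈ interior P.carrier} ∩ ({q | q.2 ≠ 0} ∩
      ⋂ w ∈ P.vertices, {q : Plane × Plane |
        ¬ (cross q.2 (w - q.1) = 0 ∧ segment ℝ q.1 w ⊆ P.carrier)}) := by
    ext q; simp [vertexFree]
  rw [this]
  exact (isOpen_interior.preimage continuous_fst).inter ((isOpen_ne.preimage continuous_snd).inter
    (isOpen_biInter_finset fun w _ => isOpen_not_through w))

lemma continuousAt_chord {p u : Plane}
    (h1 : ContinuousAt (fun q : Plane × Plane => P.reach q.1 q.2) (p, u))
    (h2 : ContinuousAt (fun q : Plane × Plane => P.reach q.1 q.2) (p, -u)) :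
    ContinuousAt (fun q : Plane × Plane => P.chord q.1 q.2) (p, u) := by
  have h3 : ContinuousAt (fun q : Plane × Plane => P.reach q.1 (-q.2)) (p, u) := by
    have hc : ContinuousAt (fun q : Plane × Plane => (q.1, -q.2)) (p, u) := by fun_prop
    exact ContinuousAt.comp (f := fun q : Plane × Plane => (q.1, -q.2)) h2 hc
  have h4 : ContinuousAt (fun q : Plane × Plane =>
      (q.1 + (-P.reach q.1 (-q.2)) • q.2, q.1 + P.reach q.1 q.2 • q.2)) (p, u) := by
    fun_prop
  exact continuous_segmentCompacts.continuousAt.comp h4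

lemma continuousOn_chord_vertexFree :
    ContinuousOn (fun q : Plane × Plane => P.chord q.1 q.2) P.vertexFree := by
  rintro ⟨p, u⟩ ⟨hp, hu, hv⟩
  refine (continuousAt_chord (continuousAt_reach hp hu ?_)
    (continuousAt_reach hp (neg_ne_zero.2 hu) ?_)).continuousWithinAt
  · rintro w hw c - hwc hs
    exact hv w hw ⟨by simp [hwc, cross_smul_right], hs⟩
  · rintro w hw c - hwc hs
    refine hv w hw ⟨?_, hs⟩
    have : w - p = (-c) • u := by rw [hwc]; module
    simp only [this, cross_smul_right, cross_self_eq_zero, mul_zero]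

lemma chord_of_mem_vertexFree {q : Plane × Plane} (hq : q ∈ P.vertexFree) :
    P.chord q.1 q.2 ∈ P.maximalSegments ∧ P.contacts (P.chord q.1 q.2) = ∅ := by
  obtain ⟨hp, hu, hv⟩ := hq
  refine ⟨chord_mem_maximalSegments (interior_subset hp) hu (Or.inl (reach_pos hp hu)), ?_⟩
  rw [eq_empty_iff_forall_notMem]
  rintro w ⟨hw, hw'⟩
  exact hv w hw ((mem_chord_iff (interior_subset hp) hu).1 hw')

lemma cell_chord_eq {T : Set (Plane × Plane)} (hT : IsPreconnected T) (hsub : T ⊆ P.vertexFree)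
    {q q' : Plane × Plane} (hq : q ∈ T) (hq' : q' ∈ T) :
    P.cell (P.chord q.1 q.2) = P.cell (P.chord q'.1 q'.2) :=
  cell_eq_cell (Φ := fun q : Plane × Plane => P.chord q.1 q.2) hT
    (continuousOn_chord_vertexFree.mono hsub)
    (fun _ hx => chord_of_mem_vertexFree (hsub hx)) hq hq'

end PolygonalRegion

/-! ### Labels, and inverse slopes at a vertex. -/

/-- A non-horizontal direction, given by its inverse slope. -/
noncomputable def dir (x : ℝ) : Plane := !₂[x, 1]

@[simp] lemma dir_zero (x : ℝ) : dir x 0 = x := rfl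

@[simp] lemma dir_one (x : ℝ) : dir x 1 = 1 := rfl

lemma dir_ne_zero (x : ℝ) : dir x ≠ 0 := by
  intro h
  have := congrArg (fun z : Plane => z 1) h
  simp at this

lemma continuous_dir : Continuous dir := by
  unfold dir; fun_prop

lemma cross_dir (x y : ℝ) : cross (dir x) (dir y) = x - y := by
  simp [cross]

/-- An element may carry several labels; choosing one for each is injective because no label is
shared. -/
lemma encard_le_of_labels {α β : Type*} {S : Set α} {L : Finset β} {R : β → α → Prop}
    (h1 : ∀ C ∈ S, ∃ l ∈ L, R l C) (h2 : ∀ l, ∀ C ∈ S, ∀ C' ∈ S, R l C → R l C' → C = C') :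
    S.encard ≤ L.card := by
  classical
  choose f hf using h1
  rcases S.eq_empty_or_nonempty with rfl | ⟨C₀, hC₀⟩
  · simp
  rw [← Set.encard_coe_eq_coe_finsetCard]
  refine encard_le_encard_of_injOn (f := fun C => if h : C ∈ S then f C h else f C₀ hC₀) ?_ ?_
  · intro C hC
    simpa [hC] using (hf C hC).1
  · intro C hC C' hC' h
    simp only [hC, hC', dif_pos] at h
    exact h2 _ C hC C' hC' (hf C hC).2 (h ▸ (hf C' hC').2)

namespace PolygonalRegion

variable {P : PolygonalRegion}

variable (P) in
/-- The inverse slopes of the lines joining `v` to other vertices. -/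
noncomputable def slopes (v : Plane) : Finset ℝ :=
  (P.vertices.filter fun w => (w - v) 1 ≠ 0).image fun w => (w - v) 0 / (w - v) 1

variable (P) in
/-- The number of those inverse slopes below `x`. -/
noncomputable def slopeRank (v : Plane) (x : ℝ) : ℕ := ((P.slopes v).filter (· < x)).card

lemma slopeRank_le (v : Plane) (x : ℝ) : P.slopeRank v x ≤ P.vertices.card :=
  (Finset.card_filter_le _ _).trans (Finset.card_image_le.trans (Finset.card_filter_le _ _))

lemma exists_vertex_of_mem_slopes {v : Plane} {x : ℝ} (h : x ∈ P.slopes v) :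
    ∃ w ∈ P.vertices, w ≠ v ∧ cross (dir x) (w - v) = 0 := by
  simp only [slopes, Finset.mem_image, Finset.mem_filter] at h
  obtain ⟨w, ⟨hw, h1⟩, rfl⟩ := h
  refine ⟨w, hw, fun h => h1 (by simp [h]), ?_⟩
  simp only [cross, dir_zero, dir_one]
  field_simp; ring

lemma eq_of_not_mem_slopes {v w : Plane} {x : ℝ} (h : x ∉ P.slopes v) (hw : w ∈ P.vertices)
    (hc : cross (dir x) (w - v) = 0) : w = v := by
  obtain ⟨c, hc⟩ := exists_smul_of_cross_eq_zero (dir_ne_zero x) hc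
  have h1 : (w - v) 1 = c := by rw [hc]; simp
  have h0 : (w - v) 0 = c * x := by rw [hc]; simp
  by_cases h2 : c = 0
  · rw [h2, zero_smul, sub_eq_zero] at hc
    exact hc
  · refine absurd ?_ h
    simp only [slopes, Finset.mem_image, Finset.mem_filter]
    exact ⟨w, ⟨hw, by rwa [h1]⟩, by rw [h0, h1]; field_simp⟩

/-- The rank counts strictly smaller slopes, so a slope in `[x, y)` counts for `y` but not for `x`.
Including `z = x` shows that a slope is determined by its rank. -/
lemma not_mem_slopes_of_slopeRank_eq {v : Plane} {x y z : ℝ}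
    (h : P.slopeRank v x = P.slopeRank v y) (h1 : x ≤ z) (h2 : z < y) : z ∉ P.slopes v := by
  intro hz
  refine h.not_lt (Finset.card_lt_card ?_)
  rw [Finset.ssubset_iff_of_subset]
  · exact ⟨z, by simp [hz, h2], by simp [h1]⟩
  · intro b hb
    simp only [Finset.mem_filter] at hb ⊢
    exact ⟨hb.1, by linarith [hb.2]⟩

lemma not_mem_slopes_of_mem_uIcc {v : Plane} {x y z : ℝ}
    (h : P.slopeRank v x = P.slopeRank v y) (hx : x ∉ P.slopes v) (hy : y ∉ P.slopes v)
    (hz : z ∈ uIcc x y) : z ∉ P.slopes v := by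
  rcases mem_uIcc.1 hz with ⟨h1, h2⟩ | ⟨h1, h2⟩
  · rcases h2.eq_or_lt with rfl | h2
    · exact hy
    · exact not_mem_slopes_of_slopeRank_eq h h1 h2
  · rcases h2.eq_or_lt with rfl | h2
    · exact hx
    · exact not_mem_slopes_of_slopeRank_eq h.symm h1 h2

lemma mem_of_mem_edgeSegment {v : Plane} (hv : v ∈ P.vertices) {e : Sym2 Plane} (he : e ∈ P.edges)
    (hve : v ∈ edgeSegment e) : v ∈ e := by
  obtain ⟨f, hf, hvf⟩ := (P.mem_vertices_iff v).1 hv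
  by_cases hef : e = f
  · exact hef ▸ hvf
  refine (P.inter_subset e he f hf hef ⟨hve, ?_⟩).1
  induction f with
  | _ a b =>
    rw [edgeSegment_mk]
    rcases Sym2.mem_iff.1 hvf with rfl | rfl
    · exact left_mem_segment ℝ _ _
    · exact right_mem_segment ℝ _ _

/-! ### Chords through a vertex: nodes and seams. -/

/-- Near a vertex `v`, a sector without directions to other vertices is either inside or outside
of the region. -/
lemma exists_sector {v : Plane} (hv : v ∈ P.vertices) {K : Set ℝ} (hK : IsCompact K)
    (hKc : IsPreconnected K) (hs : ∀ y ∈ K, y ∉ P.slopes v) {σ : ℝ} (hσ : σ ≠ 0) :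
    ∃ δ : ℝ, 0 < δ ∧ ((∀ y ∈ K, ∀ t ∈ Ioc 0 δ, v + t • (σ • dir y) ∈ interior P.carrier) ∨
      ∀ y ∈ K, ∀ t ∈ Ioc 0 δ, v + t • (σ • dir y) ∉ P.carrier) := by
  have hcont : Continuous fun z : ℝ × ℝ => v + z.1 • (σ • dir z.2) := by
    have := continuous_dir
    fun_prop
  have hnear := hK.eventually_forall_of_forall_eventually (x₀ := (0 : ℝ))
    (P := fun t y => v + t • (σ • dir y) ∈ frontier P.carrier →
      ∃ e ∈ P.edges, v ∈ edgeSegment e ∧ v + t • (σ • dir y) ∈ edgeSegment e)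
    (fun y _ => by
      have := hcont.tendsto (0, y)
      simp only [zero_smul, add_zero] at this
      exact this.eventually (P.eventually_frontier v))
  obtain ⟨r, hr, hball⟩ := Metric.eventually_nhds_iff_ball.1 hnear
  refine ⟨r / 2, by positivity, ?_⟩
  have hdisj : Disjoint ((fun z : ℝ × ℝ => v + z.1 • (σ • dir z.2)) '' (Ioc 0 (r / 2) ×ˢ K))
      (frontier P.carrier) := by
    rw [disjoint_left]
    rintro _ ⟨⟨t, y⟩, ⟨ht, hy⟩, rfl⟩ hf
    simp only at ht hy hf
    obtain ⟨e, he, hve, hze⟩ := hball t (by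
      rw [mem_ball_zero_iff, Real.norm_of_nonneg ht.1.le]; linarith [ht.2]) y hy hf
    -- An edge through `v` ends at `v`, so a frontier point of the sector would give the direction
    -- of another vertex.
    have hvin := mem_of_mem_edgeSegment hv he hve
    obtain ⟨w, rfl⟩ := Sym2.mem_iff_exists.1 hvin
    have hwV : w ∈ P.vertices := (P.mem_vertices_iff w).2 ⟨_, he, by simp⟩
    have hvw : v ≠ w := fun h => P.not_isDiag _ he (by simpa using h)
    rw [edgeSegment_mk, segment_eq_image'] at hze
    obtain ⟨θ, -, hθ⟩ := hze
    have h1 : θ • (w - v) = (t * σ) • dir y := by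
      have := add_left_cancel hθ
      rw [this, smul_smul]
    have h2 : θ * cross (dir y) (w - v) = 0 := by
      rw [← cross_smul_right, h1, cross_smul_right, cross_self_eq_zero, mul_zero]
    rcases mul_eq_zero.1 h2 with h | h
    · rw [h, zero_smul] at h1
      exact smul_ne_zero (mul_ne_zero ht.1.ne' hσ) (dir_ne_zero y) h1.symm
    · exact hvw (eq_of_not_mem_slopes (hs y hy) hwV h).symm
  have hpre := (isPreconnected_Ioc (a := (0 : ℝ)) (b := r / 2)).prod hKc |>.image _
    hcont.continuousOn
  rcases hpre.subset_interior_or_disjoint P.isClosed_carrier hdisj with h | h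
  · exact Or.inl fun y hy t ht => h ⟨(t, y), ⟨ht, hy⟩, rfl⟩
  · exact Or.inr fun y hy t ht => disjoint_left.1 h ⟨(t, y), ⟨ht, hy⟩, rfl⟩

lemma reach_add {p u : Plane} (hu : u ≠ 0) {δ : ℝ} (hδ : 0 ≤ δ)
    (h : ∀ s ∈ Icc 0 δ, p + s • u ∈ P.carrier) :
    P.reach p u = δ + P.reach (p + δ • u) u := by
  have hp : p ∈ P.carrier := by simpa using h 0 ⟨le_rfl, hδ⟩
  have hδr := le_reach hu hδ h
  apply le_antisymm
  · have : P.reach p u - δ ≤ P.reach (p + δ • u) u := le_reach hu (by linarith) fun s hs => by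
      rw [add_assoc, ← add_smul]
      exact mem_of_le_reach hp (by linarith [hs.1]) (by linarith [hs.2])
    linarith
  · refine le_reach hu (by linarith [reach_nonneg (P := P) (p + δ • u) u]) fun s hs => ?_
    rcases le_total s δ with h1 | h1
    · exact h s ⟨hs.1, h1⟩
    · have : p + s • u = (p + δ • u) + (s - δ) • u := by module
      rw [this]
      exact mem_of_le_reach (h δ ⟨hδ, le_rfl⟩) (by linarith) (by linarith [hs.2])

/-- A vertex lies on the boundary, so `continuousAt_reach` does not apply at `v`. If the sector is
inside, the base point is shifted by `δ` into the interior; if it is outside, the reach vanishes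
throughout. -/
lemma continuousOn_reach_vertex {v : Plane} (hv : v ∈ P.vertices) (hvP : v ∈ P.carrier)
    {K : Set ℝ} (hK : IsCompact K) (hKc : IsPreconnected K) (hs : ∀ y ∈ K, y ∉ P.slopes v)
    {σ : ℝ} (hσ : σ ≠ 0) :
    ContinuousOn (fun y => P.reach v (σ • dir y)) K ∧
      ((∀ y ∈ K, 0 < P.reach v (σ • dir y)) ∨ ∀ y ∈ K, P.reach v (σ • dir y) = 0) := by
  obtain ⟨δ, hδ, h | h⟩ := exists_sector hv hK hKc hs hσ
  · have hadd : ∀ y ∈ K, P.reach v (σ • dir y) =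
        δ + P.reach (v + δ • (σ • dir y)) (σ • dir y) := fun y hy =>
      reach_add (smul_ne_zero hσ (dir_ne_zero y)) hδ.le fun s hs' => by
        rcases hs'.1.eq_or_lt with rfl | h0
        · simpa using hvP
        · exact interior_subset (h y hy s ⟨h0, hs'.2⟩)
    refine ⟨?_, Or.inl fun y hy => ?_⟩
    · refine ContinuousOn.congr (f := fun y => δ + P.reach (v + δ • (σ • dir y)) (σ • dir y))
        (fun y hy => ?_) hadd
      have hc : Continuous fun y : ℝ => (v + δ • (σ • dir y), σ • dir y) := by
        have := continuous_dir
        fun_prop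
      have hne := smul_ne_zero hσ (dir_ne_zero y)
      have := continuousAt_reach (h y hy δ ⟨hδ, le_rfl⟩) hne (by
        intro w hw c hc hwc _
        have hw' : w - v = ((δ + c) * σ) • dir y := by rw [hwc]; module
        have := eq_of_not_mem_slopes (hs y hy) hw (by
          rw [hw', cross_smul_right, cross_self_eq_zero, mul_zero])
        rw [this, sub_self] at hw'
        exact smul_ne_zero (mul_ne_zero (by linarith) hσ) (dir_ne_zero y) hw'.symm)
      have h2 := ContinuousAt.comp (f := fun y : ℝ => (v + δ • (σ • dir y), σ • dir y)) this
        hc.continuousAt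
      exact (continuousAt_const.add h2).continuousWithinAt
    · rw [hadd y hy]
      linarith [reach_nonneg (P := P) (v + δ • (σ • dir y)) (σ • dir y)]
  · have hz : ∀ y ∈ K, P.reach v (σ • dir y) = 0 := by
      intro y hy
      by_contra hne
      have hpos := lt_of_le_of_ne (reach_nonneg v _) (Ne.symm hne)
      refine h y hy (min δ (P.reach v (σ • dir y) / 2)) ⟨lt_min hδ (by linarith), min_le_left _ _⟩ ?_
      exact mem_of_lt_reach (lt_min hδ (by linarith)).le
        ((min_le_right _ _).trans_lt (by linarith))
    exact ⟨continuousOn_const.congr hz, Or.inr hz⟩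

lemma vertices_subset_carrier {v : Plane} (hv : v ∈ P.vertices) : v ∈ P.carrier := by
  obtain ⟨e, he, hve⟩ := (P.mem_vertices_iff v).1 hv
  apply P.edgeSegment_subset_carrier he
  induction e with
  | _ a b =>
    rw [edgeSegment_mk]
    rcases Sym2.mem_iff.1 hve with rfl | rfl
    · exact left_mem_segment ℝ _ _
    · exact right_mem_segment ℝ _ _

lemma reach_pos_of_chord_mem {p u : Plane} (h : P.chord p u ∈ P.maximalSegments) :
    0 < P.reach p u ∨ 0 < P.reach p (-u) := by
  by_contra! hcon
  have h1 := le_antisymm hcon.1 (reach_nonneg _ _)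
  have h2 := le_antisymm hcon.2 (reach_nonneg _ _)
  obtain ⟨a, b, hab, hs⟩ := h.1.1
  rw [chord, coe_segmentCompacts, h1, h2] at hs
  simp only [neg_zero, zero_smul, add_zero, segment_same] at hs
  have ha : a ∈ ({p} : Set Plane) := hs ▸ left_mem_segment ℝ a b
  have hb : b ∈ ({p} : Set Plane) := hs ▸ right_mem_segment ℝ a b
  exact hab (ha.trans hb.symm)

/-- Chords through a vertex whose directions are not separated by a direction to another vertex
belong to the same seam. -/
lemma cell_chord_vertex_eq {v : Plane} (hv : v ∈ P.vertices) {x y : ℝ}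
    (hs : ∀ z ∈ uIcc x y, z ∉ P.slopes v) (hmax : P.chord v (dir x) ∈ P.maximalSegments) :
    P.cell (P.chord v (dir x)) = P.cell (P.chord v (dir y)) := by
  have hvP := vertices_subset_carrier hv
  have hK : IsCompact (uIcc x y) := isCompact_uIcc
  have hKc : IsPreconnected (uIcc x y) := isPreconnected_uIcc
  obtain ⟨c1, p1⟩ := continuousOn_reach_vertex hv hvP hK hKc hs (one_ne_zero (α := ℝ))
  obtain ⟨c2, p2⟩ := continuousOn_reach_vertex hv hvP hK hKc hs (neg_ne_zero.2 (one_ne_zero (α := ℝ)))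
  simp only [one_smul, neg_smul] at c1 p1 c2 p2
  refine cell_eq_cell (Φ := fun z => P.chord v (dir z)) hKc ?_ (c := {v}) ?_ left_mem_uIcc
    right_mem_uIcc
  · have hd := continuous_dir
    refine continuous_segmentCompacts.comp_continuousOn
      (f := fun z => (v + (-P.reach v (-dir z)) • dir z, v + P.reach v (dir z) • dir z)) ?_
    fun_prop
  · intro z hz
    refine ⟨chord_mem_maximalSegments hvP (dir_ne_zero z) ?_, ?_⟩
    · rcases reach_pos_of_chord_mem hmax with h | h
      · exact Or.inl ((p1.resolve_right fun h' => h.ne' (h' x left_mem_uIcc)) z hz)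
      · exact Or.inr ((p2.resolve_right fun h' => h.ne' (h' x left_mem_uIcc)) z hz)
    · ext w
      constructor
      · rintro ⟨hw, hw'⟩
        exact eq_of_not_mem_slopes (hs z hz) hw (cross_sub_eq_zero_of_mem_chord hw')
      · rintro rfl
        exact ⟨hv, self_mem_chord _ _⟩

lemma encard_nodes_le : P.nodes.encard ≤ (P.vertices ×ˢ P.vertices).card := by
  refine encard_le_of_labels
    (R := fun (l : Plane × Plane) C => C = P.cell (P.chord l.1 (l.2 - l.1))) ?_ ?_
  · rintro C ⟨s, hs, hcard, rfl⟩
    obtain ⟨v, w, hv, hw, hvw⟩ := one_lt_encard_iff.1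
      (lt_of_lt_of_le (by norm_num : (1 : ℕ∞) < 2) hcard)
    refine ⟨(v, w), Finset.mem_product.2 ⟨hv.1, hw.1⟩, ?_⟩
    obtain ⟨a, b, hab, hse⟩ := hs.1.1
    have hne : w - v ≠ 0 := sub_ne_zero.2 hvw.symm
    have h1 := hv.2
    have h2 := hw.2
    rw [hse] at h1 h2
    obtain ⟨α, β, hα, hβ, he⟩ := exists_params_of_segment (u := b - a) h1
      (sub_ne_zero.2 hab.symm) (cross_self_eq_zero _)
    rw [he, mem_segment_line (hα.trans hβ)] at h2
    obtain ⟨t, -, -, ht⟩ := h2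
    rw [← eq_chord_of_mem_maximalSegments hs hab hse hv.2 hne]
    have : w - v = t • (b - a) := by rw [ht]; module
    rw [this, cross_smul_left, cross_self_eq_zero, mul_zero]
  · rintro l C - C' - rfl rfl
    rfl

/-- The flag separates directions between slopes (0), directions towards another vertex that is not
on the chord (1), and the horizontal direction (2), where the rank is a dummy 0. -/
lemma encard_seams_le : P.seams.encard ≤
    (P.vertices ×ˢ Finset.range (P.vertices.card + 1) ×ˢ Finset.range 3).card := by
  refine encard_le_of_labels (R := fun (l : Plane × ℕ × ℕ) C =>
    (l.2.2 = 0 ∧ l.1 ∈ P.vertices ∧ ∃ x ∉ P.slopes l.1, P.slopeRank l.1 x = l.2.1 ∧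
      P.chord l.1 (dir x) ∈ P.maximalSegments ∧ C = P.cell (P.chord l.1 (dir x))) ∨
    (l.2.2 = 1 ∧ ∃ x ∈ P.slopes l.1, P.slopeRank l.1 x = l.2.1 ∧
      C = P.cell (P.chord l.1 (dir x))) ∨
    (l.2.2 = 2 ∧ C = P.cell (P.chord l.1 !₂[1, 0]))) ?_ ?_
  · rintro C ⟨s, hs, hcard, rfl⟩
    obtain ⟨v, hsv⟩ := encard_eq_one.1 hcard
    have hv : v ∈ P.contacts s := hsv ▸ mem_singleton v
    obtain ⟨a, b, hab, hse⟩ := hs.1.1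
    by_cases hba : (b - a) 1 = 0
    · refine ⟨(v, 0, 2), by simp [hv.1], Or.inr (Or.inr ⟨rfl, ?_⟩)⟩
      rw [← eq_chord_of_mem_maximalSegments hs hab hse hv.2]
      · intro h
        have := congrArg (fun z : Plane => z 0) h
        simp at this
      · rw [cross, hba]; simp
    · have heq : s = P.chord v (dir ((b - a) 0 / (b - a) 1)) :=
        eq_chord_of_mem_maximalSegments hs hab hse hv.2 (dir_ne_zero _) (by
          simp only [cross, dir_zero, dir_one]; field_simp; ring)
      have hr := slopeRank_le (P := P) v ((b - a) 0 / (b - a) 1)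
      by_cases hsl : (b - a) 0 / (b - a) 1 ∈ P.slopes v
      · exact ⟨(v, P.slopeRank v ((b - a) 0 / (b - a) 1), 1), Finset.mk_mem_product hv.1
          (Finset.mk_mem_product (Finset.mem_range.2 (Nat.lt_succ_of_le hr)) (by simp)),
          Or.inr (Or.inl ⟨rfl, _, hsl, rfl, by rw [← heq]⟩)⟩
      · exact ⟨(v, P.slopeRank v ((b - a) 0 / (b - a) 1), 0), Finset.mk_mem_product hv.1
          (Finset.mk_mem_product (Finset.mem_range.2 (Nat.lt_succ_of_le hr)) (by simp)),
          Or.inl ⟨rfl, hv.1, _, hsl, rfl, heq ▸ hs, by rw [← heq]⟩⟩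
  · rintro ⟨v, k, f⟩ C - C' - h h'
    dsimp only at h h'
    rcases h with ⟨hf, hv, x, hx, hk, hm, rfl⟩ | ⟨hf, x, hx, hk, rfl⟩ | ⟨hf, rfl⟩
    · obtain ⟨-, -, x', hx', hk', -, rfl⟩ := h'.resolve_right (by omega)
      exact cell_chord_vertex_eq hv
        (fun z hz => not_mem_slopes_of_mem_uIcc (hk.trans hk'.symm) hx hx' hz) hm
    · obtain ⟨-, x', hx', hk', rfl⟩ := (h'.resolve_left (by omega)).resolve_right (by omega)
      rcases lt_trichotomy x x' with h | rfl | h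
      · exact absurd hx (not_mem_slopes_of_slopeRank_eq (hk.trans hk'.symm) le_rfl h)
      · rfl
      · exact absurd hx' (not_mem_slopes_of_slopeRank_eq (hk'.trans hk.symm) le_rfl h)
    · obtain ⟨-, rfl⟩ := (h'.resolve_left (by omega)).resolve_left (by omega)
      rfl

end PolygonalRegion

/-! ### Patches: general position, and turning towards a visible vertex. -/

lemma cross_dir_left (y : ℝ) (d : Plane) : cross (dir y) d = y * d 1 - d 0 := by
  simp [cross]

lemma dense_cross_ne_zero {d : Plane} (hd : d ≠ 0) (v : Plane) :
    Dense {p : Plane | cross d (p - v) ≠ 0} := by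
  obtain ⟨c, hc⟩ : ∃ c : Plane, cross d c ≠ 0 := by
    by_contra! h
    apply hd
    have h0 := h !₂[1, 0]
    have h1 := h !₂[0, 1]
    simp [cross] at h0 h1
    ext i; fin_cases i <;> simp [h0, h1]
  intro p
  have ht : Tendsto (fun t : ℝ => p + t • c) (𝓝[≠] 0) (𝓝 p) := by
    have hcont : Continuous fun t : ℝ => p + t • c := by fun_prop
    have := hcont.tendsto 0
    simp only [zero_smul, add_zero] at this
    exact this.mono_left nhdsWithin_le_nhds
  have hval : ∀ t : ℝ, cross d (p + t • c - v) = cross d (p - v) + t * cross d c := by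
    intro t
    rw [add_sub_right_comm, cross_add_right, cross_smul_right]
  refine mem_closure_of_tendsto ht ?_
  simp only [mem_ofPred_eq, hval]
  by_cases h0 : cross d (p - v) = 0
  · filter_upwards [self_mem_nhdsWithin] with t ht'
    rw [h0, zero_add]
    exact mul_ne_zero ht' hc
  · have hcont : Continuous fun t : ℝ => cross d (p - v) + t * cross d c := by fun_prop
    exact mem_nhdsWithin_of_mem_nhds
      ((hcont.tendsto 0).eventually (isOpen_ne.mem_nhds (by simpa using h0)))

lemma dense_cross_ne_zero_of_finite {ι : Type*} (S : Finset ι) (d v : ι → Plane)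
    (hd : ∀ i ∈ S, d i ≠ 0) : Dense {p : Plane | ∀ i ∈ S, cross (d i) (p - v i) ≠ 0} := by
  have : {p : Plane | ∀ i ∈ S, cross (d i) (p - v i) ≠ 0} =
      ⋂ i ∈ (S : Set ι), {p | cross (d i) (p - v i) ≠ 0} := by
    ext p; simp
  rw [this]
  refine dense_biInter_of_isOpen (fun i _ => ?_) S.countable_toSet
    fun i hi => dense_cross_ne_zero (hd i hi) (v i)
  exact isOpen_ne.preimage (continuous_const.cross (by fun_prop))

namespace PolygonalRegion

variable {P : PolygonalRegion}

lemma add_reach_mem_frontier {p u : Plane} (hp : p ∈ P.carrier) (hu : u ≠ 0) :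
    p + P.reach p u • u ∈ frontier P.carrier := by
  refine (P.mem_interior_or_mem_frontier
    (mem_of_le_reach hp (reach_nonneg _ _) le_rfl)).resolve_left fun h => ?_
  have h1 := reach_pos h hu
  have h2 := reach_add (P := P) (p := p) hu (reach_nonneg (P := P) p u)
    fun s hs => mem_of_le_reach hp hs.1 hs.2
  linarith

/-- Every interior point sees a vertex: otherwise the ends of all its chords lie on one edge. -/
lemma exists_visible_vertex {p : Plane} (hp : p ∈ interior P.carrier) :
    ∃ w ∈ P.vertices, segment ℝ p w ⊆ P.carrier := by
  by_contra! hno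
  have hpP := interior_subset hp
  set h : Plane → Plane := fun u => p + P.reach p u • u with hh
  have hcont : ContinuousOn h {0}ᶜ := by
    intro u hu
    have h1 := continuousAt_reach (P := P) hp hu fun w hw _ _ _ => hno w hw
    have h2 : ContinuousAt (fun u => P.reach p u) u :=
      ContinuousAt.comp (f := fun u : Plane => (p, u)) h1 (by fun_prop)
    exact (continuousAt_const.add (h2.smul continuousAt_id)).continuousWithinAt
  have hnv : ∀ u, u ≠ 0 → h u ∉ P.vertices := fun u hu hv =>
    hno _ hv ((mem_chord_iff hpP hu).1 (mem_chord_iff_exists.2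
      ⟨P.reach p u, by linarith [reach_nonneg (P := P) p u, reach_nonneg (P := P) p (-u)],
        le_rfl, rfl⟩)).2
  -- The punctured plane is connected. Ends on two different edges would force some end onto a
  -- common point of two edges, that is, a vertex.
  have hconn : IsPreconnected (h '' {0}ᶜ) := by
    refine IsPreconnected.image (IsConnected.isPreconnected ?_) h hcont
    refine isConnected_compl_singleton_of_one_lt_rank ?_ 0
    rw [← Module.finrank_eq_rank, finrank_euclideanSpace_fin]
    norm_num
  have hu1 := dir_ne_zero 0
  obtain ⟨e, he, hue⟩ := P.exists_edge_of_mem_frontier (add_reach_mem_frontier hpP hu1)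
  have hall : ∀ u, u ≠ 0 → h u ∈ edgeSegment e := by
    intro u hu
    by_contra hue'
    obtain ⟨f, hf, huf⟩ := P.exists_edge_of_mem_frontier (add_reach_mem_frontier hpP hu)
    have hfe : f ≠ e := fun hfe => hue' (hfe ▸ huf)
    obtain ⟨_, ⟨u', hu', rfl⟩, h1, h2⟩ := isPreconnected_closed_iff.1 hconn (edgeSegment e)
      (⋃ g ∈ {g | g ∈ P.edges ∧ g ≠ e}, edgeSegment g) (isClosed_edgeSegment e)
      ((P.edges.finite_toSet.subset fun g hg => hg.1).isClosed_biUnion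
        fun g _ => isClosed_edgeSegment g)
      (by
        rintro _ ⟨u', hu', rfl⟩
        obtain ⟨g, hg, hug⟩ := P.exists_edge_of_mem_frontier (add_reach_mem_frontier hpP hu')
        by_cases hge : g = e
        · exact Or.inl (hge ▸ hug)
        · exact Or.inr (mem_biUnion (x := g) ⟨hg, hge⟩ hug))
      ⟨_, ⟨_, hu1, rfl⟩, hue⟩ ⟨_, ⟨u, hu, rfl⟩, mem_biUnion (x := f) ⟨hf, hfe⟩ huf⟩
    simp only [mem_iUnion] at h2
    obtain ⟨g, ⟨hg, hge⟩, hug⟩ := h2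
    exact hnv u' hu' ((P.mem_vertices_iff _).2 ⟨e, he, (P.inter_subset e he g hg hge.symm
      ⟨h1, hug⟩).1⟩)
  -- The ends in opposite directions lie on the same convex edge, which then contains `p`.
  have hpe : p ∈ edgeSegment e := by
    have hsub := (convex_edgeSegment e).segment_subset (hall _ (neg_ne_zero.2 hu1)) (hall _ hu1)
    apply hsub
    have e1 : h (-dir 0) = p + (-P.reach p (-dir 0)) • dir 0 := by rw [hh]; module
    rw [e1, mem_segment_line]
    · exact ⟨0, by linarith [reach_nonneg (P := P) p (-dir 0)], reach_nonneg _ _, by simp⟩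
    · linarith [reach_nonneg (P := P) p (-dir 0), reach_nonneg (P := P) p (dir 0)]
  exact (P.edgeSegment_subset_frontier he hpe).2 hp

/-- A maximal segment without vertices is a chord through an interior point. -/
lemma exists_vertexFree_of_contacts_eq_empty {s : NonemptyCompacts Plane}
    (hs : s ∈ P.maximalSegments) (hc : P.contacts s = ∅) :
    ∃ q ∈ P.vertexFree, s = P.chord q.1 q.2 := by
  obtain ⟨a, b, hab, hse⟩ := hs.1.1
  have hu : b - a ≠ 0 := sub_ne_zero.2 hab.symm
  set x := a + (1 / 2 : ℝ) • (b - a) with hx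
  have hline : ∀ t : ℝ, |t| ≤ 1 / 2 → x + t • (b - a) ∈ (s : Set Plane) := by
    intro t ht
    rw [hse, segment_eq_image']
    have := abs_le.1 ht
    exact ⟨1 / 2 + t, ⟨by linarith, by linarith⟩, by simp only [hx]; module⟩
  have hxs : x ∈ (s : Set Plane) := by simpa using hline 0 (by norm_num)
  have hsx : s = P.chord x (b - a) :=
    eq_chord_of_mem_maximalSegments hs hab hse hxs hu (cross_self_eq_zero _)
  have hxP := hs.1.2 hxs
  have hfree : ∀ w ∈ P.vertices, ¬ (cross (b - a) (w - x) = 0 ∧ segment ℝ x w ⊆ P.carrier) := by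
    intro w hw h
    have : w ∈ P.contacts s := ⟨hw, by rw [hsx]; exact (mem_chord_iff hxP hu).2 h⟩
    rw [hc] at this
    exact this
  refine ⟨(x, b - a), ⟨?_, hu, hfree⟩, hsx⟩
  by_contra hxi
  obtain ⟨w, hw, c, -, hwc, hws⟩ := P.exists_vertex_of_not_mem_interior hu (by norm_num)
    (fun t ht => hs.1.2 (hline t ht)) hxi fun hxv =>
      hfree x hxv ⟨by simp [cross], by simpa using hxP⟩
  exact hfree w hw ⟨by rw [hwc, add_sub_cancel_left, cross_smul_right, cross_self_eq_zero,
    mul_zero], hws⟩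

/-- Every patch contains a chord through a point in general position. -/
lemma exists_generic_chord {s : NonemptyCompacts Plane} (hs : s ∈ P.maximalSegments)
    (hc : P.contacts s = ∅) :
    ∃ p x, (p, dir x) ∈ P.vertexFree ∧ P.cell s = P.cell (P.chord p (dir x)) ∧
      (∀ v ∈ P.vertices, (v - p) 1 ≠ 0) ∧
      ∀ v ∈ P.vertices, ∀ w ∈ P.vertices, v ≠ w → cross (w - v) (p - v) ≠ 0 := by
  obtain ⟨q, hq, rfl⟩ := exists_vertexFree_of_contacts_eq_empty hs hc
  obtain ⟨r, hr, hball⟩ := Metric.isOpen_iff.1 isOpen_vertexFree q hq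
  have hh : (!₂[1, 0] : Plane) ≠ 0 := by
    intro h
    have := congrArg (fun z : Plane => z 0) h
    simp at this
  have hD1 := dense_cross_ne_zero_of_finite P.vertices (fun _ => !₂[1, 0]) id fun _ _ => hh
  have hD2 := dense_cross_ne_zero_of_finite
    ((P.vertices ×ˢ P.vertices).filter fun z => z.1 ≠ z.2) (fun z => z.2 - z.1) (fun z => z.1)
    fun z hz => sub_ne_zero.2 (Finset.mem_filter.1 hz).2.symm
  have hO1 : IsOpen {p : Plane | ∀ i ∈ P.vertices, cross !₂[1, 0] (p - id i) ≠ 0} := by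
    have : {p : Plane | ∀ i ∈ P.vertices, cross !₂[1, 0] (p - id i) ≠ 0} =
        ⋂ i ∈ P.vertices, {p | cross !₂[1, 0] (p - id i) ≠ 0} := by
      ext p; simp
    rw [this]
    exact isOpen_biInter_finset fun i _ =>
      isOpen_ne.preimage (continuous_const.cross (by fun_prop))
  -- Generic pairs: `p` off the horizontals through vertices and off the lines joining vertices, and
  -- `u` not horizontal.
  have hD := (hD2.inter_of_isOpen_right hD1 hO1).prod (dense_cross_ne_zero hh 0)
  obtain ⟨⟨p, u⟩, hpu, ⟨hp2, hp1⟩, hu1⟩ :=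
    hD.inter_open_nonempty _ Metric.isOpen_ball ⟨q, Metric.mem_ball_self hr⟩
  have hu0 : u 1 ≠ 0 := by simpa [cross] using hu1
  have hud : u = u 1 • dir (u 0 / u 1) := by
    ext i; fin_cases i
    · simp; field_simp
    · simp
  have hvf := hball hpu
  have hcr : cross u (dir (u 0 / u 1)) = 0 := by
    simp [cross]; field_simp; ring
  have hcell : P.cell (P.chord q.1 q.2) = P.cell (P.chord p u) :=
    cell_chord_eq (q := q) (q' := (p, u)) (convex_ball q r).isPreconnected hball
      (Metric.mem_ball_self hr) hpu
  refine ⟨p, u 0 / u 1, ⟨hvf.1, dir_ne_zero _, ?_⟩, ?_, ?_, ?_⟩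
  · rintro w hw ⟨h1, h2⟩
    refine hvf.2.2 w hw ⟨?_, h2⟩
    simp only at h1 ⊢
    rw [hud, cross_smul_left, h1, mul_zero]
  · rw [hcell, chord_eq_chord (chord_of_mem_vertexFree hvf).1 hvf.2.1 (dir_ne_zero _) hcr
      (self_mem_chord p u)]
  · intro v hv h
    have := hp1 v hv
    simp [cross] at this h
    exact this (by linarith)
  · intro v hv w hw hvw
    exact hp2 (v, w) (by simp [hv, hw, hvw])

/-- Chords close to those through a vertex `v` from nearby interior points, turned slightly. -/
lemma eventually_mem_vertexFree {v : Plane} {σ η : ℝ} (hσ : σ ≠ 0) (hη : η ≠ 0) {t y : ℝ}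
    (ht : 0 < t) (hy : y ∉ P.slopes v) (hint : v + t • (σ • dir y) ∈ interior P.carrier) :
    ∀ᶠ z : ℝ × (ℝ × ℝ) in 𝓝 (0, (t, y)), 0 < z.1 →
      (v + z.2.1 • (σ • dir z.2.2), dir (z.2.2 + η * z.1)) ∈ P.vertexFree := by
  have hd := continuous_dir
  have hc1 : Continuous fun z : ℝ × (ℝ × ℝ) => v + z.2.1 • (σ • dir z.2.2) := by fun_prop
  have hc2 : Continuous fun z : ℝ × (ℝ × ℝ) => dir (z.2.2 + η * z.1) := by fun_prop
  have ev1 := (hc1.tendsto (0, (t, y))).eventually (isOpen_interior.mem_nhds hint)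
  have ev2 : ∀ᶠ z : ℝ × (ℝ × ℝ) in 𝓝 (0, (t, y)), 0 < z.2.1 :=
    ((continuous_fst.comp continuous_snd).tendsto (0, (t, y))).eventually (lt_mem_nhds ht)
  have ev3 : ∀ᶠ z : ℝ × (ℝ × ℝ) in 𝓝 (0, (t, y)), ∀ w ∈ P.vertices, w ≠ v →
      cross (dir (z.2.2 + η * z.1)) (w - (v + z.2.1 • (σ • dir z.2.2))) ≠ 0 := by
    rw [Filter.eventually_all_finset]
    intro w hw
    by_cases hwv : w = v
    · exact Eventually.of_forall fun z h => absurd hwv h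
    have hc3 := hc2.cross (continuous_const.sub hc1 : Continuous fun z : ℝ × (ℝ × ℝ) =>
      w - (v + z.2.1 • (σ • dir z.2.2)))
    have hne : cross (dir (y + η * 0)) (w - (v + t • (σ • dir y))) ≠ 0 := by
      rw [mul_zero, add_zero, ← sub_sub, cross_sub_right, cross_smul_right, cross_smul_right,
        cross_self_eq_zero, mul_zero, mul_zero, sub_zero]
      exact fun h => hwv (eq_of_not_mem_slopes hy hw h)
    filter_upwards [(hc3.tendsto (0, (t, y))).eventually (isOpen_ne.mem_nhds hne)] with z hz _
      using hz
  filter_upwards [ev1, ev2, ev3] with z h1 h2 h3 hε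
  refine ⟨h1, dir_ne_zero _, fun w hw h => ?_⟩
  by_cases hwv : w = v
  · have h4 := h.1
    simp only at h4
    rw [hwv, sub_add_cancel_left, ← neg_one_smul ℝ, cross_smul_right, cross_smul_right,
      cross_smul_right, cross_dir, add_sub_cancel_left] at h4
    -- The chord misses `v` exactly because it is turned by the nonzero amount `η * z.1`.
    have : (-1 : ℝ) * (z.2.1 * (σ * (η * z.1))) ≠ 0 := by
      have := hε.ne'
      have := h2.ne'
      positivity
    exact this h4
  · exact h3 w hw hwv h.1

/-- Compactness of `K` gives one bound on `ε` valid for all base points, so the turned chords form a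
connected vertex-free family. -/
lemma eventually_cell_eq {v : Plane} {σ η : ℝ} (hσ : σ ≠ 0) (hη : η ≠ 0) {K : Set (ℝ × ℝ)}
    (hK : IsCompact K) (hKc : IsPreconnected K)
    (hgood : ∀ z ∈ K, 0 < z.1 ∧ z.2 ∉ P.slopes v ∧
      v + z.1 • (σ • dir z.2) ∈ interior P.carrier) {z z' : ℝ × ℝ} (hz : z ∈ K) (hz' : z' ∈ K) :
    ∀ᶠ ε : ℝ in 𝓝[>] 0, P.cell (P.chord (v + z.1 • (σ • dir z.2)) (dir (z.2 + η * ε))) =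
      P.cell (P.chord (v + z'.1 • (σ • dir z'.2)) (dir (z'.2 + η * ε))) := by
  have ev := hK.eventually_forall_of_forall_eventually (x₀ := (0 : ℝ))
    (P := fun ε z => 0 < ε → (v + z.1 • (σ • dir z.2), dir (z.2 + η * ε)) ∈ P.vertexFree)
    (fun z hz => eventually_mem_vertexFree hσ hη (hgood z hz).1 (hgood z hz).2.1 (hgood z hz).2.2)
  filter_upwards [mem_nhdsWithin_of_mem_nhds ev, self_mem_nhdsWithin] with ε hε hpos
  have hc : Continuous fun z : ℝ × ℝ => (v + z.1 • (σ • dir z.2), dir (z.2 + η * ε)) := by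
    have := continuous_dir
    fun_prop
  refine cell_chord_eq (q := (v + z.1 • (σ • dir z.2), dir (z.2 + η * ε)))
    (q' := (v + z'.1 • (σ • dir z'.2), dir (z'.2 + η * ε))) (hKc.image _ hc.continuousOn) ?_
    ⟨z, hz, rfl⟩ ⟨z', hz', rfl⟩
  rintro _ ⟨z, hz, rfl⟩
  exact hε z hz hpos

/-- The ray from a vertex `v` stays in the interior up to an interior point visible from `v`. -/
lemma mem_interior_of_visible {v : Plane} {σ : ℝ} (hσ : σ ≠ 0) {y δ r : ℝ} (hδ : 0 < δ)
    (hy : y ∉ P.slopes v) (hsec : ∀ t ∈ Ioc 0 δ, v + t • (σ • dir y) ∈ interior P.carrier)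
    (hr : 0 < r) (hint : v + r • (σ • dir y) ∈ interior P.carrier)
    (hvis : segment ℝ (v + r • (σ • dir y)) v ⊆ P.carrier) {t : ℝ} (ht : t ∈ uIcc δ r) :
    v + t • (σ • dir y) ∈ interior P.carrier := by
  have hmin := ht.1
  have hmax := ht.2
  have ht0 : 0 < t := (lt_min hδ hr).trans_le hmin
  rcases le_or_gt t δ with h | h
  · exact hsec t ⟨ht0, h⟩
  have htr : t ≤ r := (le_max_iff.1 hmax).resolve_left (not_le.2 h)
  rcases htr.eq_or_lt with rfl | htr
  · exact hint
  have hu := smul_ne_zero hσ (dir_ne_zero y)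
  have hreach : r - δ ≤ P.reach (v + δ • (σ • dir y)) (σ • dir y) := by
    refine le_reach hu (by linarith) fun s hs => hvis ?_
    rw [segment_symm]
    have e1 : segment ℝ v (v + r • (σ • dir y)) =
        segment ℝ (v + (0 : ℝ) • (σ • dir y)) (v + r • (σ • dir y)) := by simp
    rw [e1, mem_segment_line hr.le]
    exact ⟨δ + s, by linarith [hs.1], by linarith [hs.2], by module⟩
  have hfin := mem_interior_of_lt_reach (hsec δ ⟨hδ, le_rfl⟩) hu (fun w hw c hc hwc _ => by
      have hw' : w - v = ((δ + c) * σ) • dir y := by rw [hwc]; module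
      have := eq_of_not_mem_slopes hy hw (by
        rw [hw', cross_smul_right, cross_self_eq_zero, mul_zero])
      rw [this, sub_self] at hw'
      exact smul_ne_zero (mul_ne_zero (by linarith) hσ) (dir_ne_zero y) hw'.symm)
    (t := t - δ) (by linarith) (by linarith)
  have e2 : v + t • (σ • dir y) = v + δ • (σ • dir y) + (t - δ) • (σ • dir y) := by module
  rwa [e2]

variable (P) in
/-- The cell `C` is found by turning, in the sense of `η`, the chord that joins an interior point
to the vertex `v`, which the point sees in a direction of rank `k` and on the side `σ`. -/
def IsPatchAt (v : Plane) (σ η : ℝ) (k : ℕ) (C : Set (NonemptyCompacts Plane)) : Prop :=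
  v ∈ P.vertices ∧ σ ≠ 0 ∧ η ≠ 0 ∧ ∃ y ∉ P.slopes v, P.slopeRank v y = k ∧ ∃ r : ℝ, 0 < r ∧
    v + r • (σ • dir y) ∈ interior P.carrier ∧ segment ℝ (v + r • (σ • dir y)) v ⊆ P.carrier ∧
    ∀ᶠ ε : ℝ in 𝓝[>] 0, P.cell (P.chord (v + r • (σ • dir y)) (dir (y + η * ε))) = C

/-- The two base points are joined by a path: radially to distance parameter `δ`, across the
slope-free sector at `δ`, and radially out. A single small `ε` serves all three pieces. -/
lemma IsPatchAt.unique {v : Plane} {σ η : ℝ} {k : ℕ} {C C' : Set (NonemptyCompacts Plane)}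
    (h : P.IsPatchAt v σ η k C) (h' : P.IsPatchAt v σ η k C') : C = C' := by
  obtain ⟨hv, hσ, hη, y, hy, hk, r, hr, hint, hvis, hC⟩ := h
  obtain ⟨-, -, -, y', hy', hk', r', hr', hint', hvis', hC'⟩ := h'
  have hslopes : ∀ z ∈ uIcc y y', z ∉ P.slopes v :=
    fun z hz => not_mem_slopes_of_mem_uIcc (hk.trans hk'.symm) hy hy' hz
  obtain ⟨δ, hδ, hsec⟩ := exists_sector hv isCompact_uIcc isPreconnected_uIcc hslopes hσ
  have hsec := hsec.resolve_right fun hout => by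
    refine hout y left_mem_uIcc (min δ r) ⟨lt_min hδ hr, min_le_left _ _⟩ (hvis ?_)
    rw [segment_symm]
    have e1 : segment ℝ v (v + r • (σ • dir y)) =
        segment ℝ (v + (0 : ℝ) • (σ • dir y)) (v + r • (σ • dir y)) := by simp
    rw [e1, mem_segment_line hr.le]
    exact ⟨_, (lt_min hδ hr).le, min_le_right _ _, rfl⟩
  have radial : ∀ {y r : ℝ}, y ∉ P.slopes v → 0 < r →
      v + r • (σ • dir y) ∈ interior P.carrier →
      segment ℝ (v + r • (σ • dir y)) v ⊆ P.carrier →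
      (∀ t ∈ Ioc 0 δ, v + t • (σ • dir y) ∈ interior P.carrier) →
      ∀ᶠ ε : ℝ in 𝓝[>] 0, P.cell (P.chord (v + r • (σ • dir y)) (dir (y + η * ε))) =
        P.cell (P.chord (v + δ • (σ • dir y)) (dir (y + η * ε))) := by
    intro y r hy hr hint hvis hsec
    refine eventually_cell_eq (K := uIcc δ r ×ˢ {y}) hσ hη (isCompact_uIcc.prod isCompact_singleton)
      (isPreconnected_uIcc.prod isPreconnected_singleton) ?_ (z := (r, y)) (z' := (δ, y))
      ⟨right_mem_uIcc, rfl⟩ ⟨left_mem_uIcc, rfl⟩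
    rintro ⟨t, y₁⟩ ⟨ht, rfl⟩
    exact ⟨(lt_min hδ hr).trans_le ht.1, hy,
      mem_interior_of_visible hσ hδ hy hsec hr hint hvis ht⟩
  have h1 := radial hy hr hint hvis (hsec y left_mem_uIcc)
  have h3 := radial hy' hr' hint' hvis' (hsec y' right_mem_uIcc)
  have h2 := eventually_cell_eq (P := P) (v := v) (K := {δ} ×ˢ uIcc y y') hσ hη
    (isCompact_singleton.prod isCompact_uIcc) (isPreconnected_singleton.prod isPreconnected_uIcc)
    (by
      rintro ⟨t, z⟩ ⟨rfl, hz⟩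
      exact ⟨hδ, hslopes z hz, hsec z hz _ ⟨hδ, le_rfl⟩⟩) (z := (δ, y)) (z' := (δ, y'))
    ⟨rfl, left_mem_uIcc⟩ ⟨rfl, right_mem_uIcc⟩
  obtain ⟨ε, h1, h2, h3, h4, h5⟩ := (h1.and (h2.and (h3.and (hC.and hC')))).exists
  rw [← h4, ← h5, h1, h2, h3]

/-- Every patch is found next to some vertex. -/
lemma exists_isPatchAt {s : NonemptyCompacts Plane} (hs : s ∈ P.maximalSegments)
    (hc : P.contacts s = ∅) : ∃ v ∈ P.vertices, ∃ σ ∈ ({1, -1} : Finset ℝ),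
      ∃ η ∈ ({1, -1} : Finset ℝ), ∃ k ∈ Finset.range (P.vertices.card + 1),
        P.IsPatchAt v σ η k (P.cell s) := by
  classical
  obtain ⟨p, x, hpx, hcell, hp1, hp2⟩ := exists_generic_chord hs hc
  rw [hcell]
  have hp := hpx.1
  obtain ⟨w₀, hw₀, hvis₀⟩ := exists_visible_vertex hp
  set slope : Plane → ℝ := fun w => (w - p) 0 / (w - p) 1 with hslope
  have hcross : ∀ w ∈ P.vertices, ∀ z, cross (dir z) (w - p) = 0 ↔ z = slope w := by
    intro w hw z
    rw [cross_dir_left, hslope, sub_eq_zero, eq_div_iff (hp1 w hw)]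
  -- Among the visible vertices, `v` is one met first when the chord is turned about `p`, in either
  -- sense.
  obtain ⟨v, hv, hmin⟩ := Finset.exists_min_image
    (P.vertices.filter fun w => segment ℝ p w ⊆ P.carrier) (fun w => |slope w - x|)
    ⟨w₀, by simp [hw₀, hvis₀]⟩
  obtain ⟨hvV, hvis⟩ := Finset.mem_filter.1 hv
  have hxv : x ≠ slope v := fun h => hpx.2.2 v hvV ⟨(hcross v hvV x).2 h, hvis⟩
  have hfree : ∀ z, |z - x| < |slope v - x| → (p, dir z) ∈ P.vertexFree := by
    intro z hz
    refine ⟨hp, dir_ne_zero z, fun w hw ⟨h1, h2⟩ => ?_⟩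
    have h3 := hmin w (by simp [hw, h2])
    rw [← (hcross w hw z).1 h1] at h3
    linarith
  have hpv : p = v + (-(v - p) 1) • dir (slope v) := by
    have := exists_smul_of_cross_eq_zero (dir_ne_zero _) ((hcross v hvV _).2 rfl)
    obtain ⟨c, hc⟩ := this
    have h1 : (v - p) 1 = c := by rw [hc]; simp
    rw [h1, neg_smul, ← hc]; abel
  obtain ⟨σ, hσ, r, hr, hpr⟩ : ∃ σ ∈ ({1, -1} : Finset ℝ), ∃ r : ℝ, 0 < r ∧
      p = v + r • (σ • dir (slope v)) := by
    rcases lt_or_gt_of_ne (hp1 v hvV) with h | h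
    · exact ⟨1, by simp, -(v - p) 1, by linarith, by rw [one_smul]; exact hpv⟩
    · exact ⟨-1, by simp, (v - p) 1, h, hpv.trans (by module)⟩
  -- The sign that turns from `v` back towards the original direction `x`.
  obtain ⟨η, hη, hturn⟩ : ∃ η ∈ ({1, -1} : Finset ℝ), η * (x - slope v) = |slope v - x| := by
    rcases lt_or_gt_of_ne hxv with h | h
    · exact ⟨-1, by simp, by rw [abs_of_pos (by linarith)]; ring⟩
    · exact ⟨1, by simp, by rw [abs_of_neg (by linarith)]; ring⟩
  have hunit : ∀ a ∈ ({1, -1} : Finset ℝ), a ≠ 0 ∧ a * a = 1 := by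
    intro a ha
    simp only [Finset.mem_insert, Finset.mem_singleton] at ha
    rcases ha with rfl | rfl <;> norm_num
  -- Otherwise `p` would lie on a line through two vertices, against its generic choice.
  have hnot : slope v ∉ P.slopes v := by
    intro h
    obtain ⟨w, hw, hwv, hcr⟩ := exists_vertex_of_mem_slopes h
    obtain ⟨c, hc⟩ := exists_smul_of_cross_eq_zero (dir_ne_zero _) hcr
    refine hp2 v hvV w hw hwv.symm ?_
    have : p - v = (r * σ) • dir (slope v) := by
      nth_rewrite 1 [hpr]; module
    rw [hc, this, cross_smul_left, cross_smul_right, cross_self_eq_zero, mul_zero, mul_zero]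
  refine ⟨v, hvV, σ, hσ, η, hη, P.slopeRank v (slope v),
    Finset.mem_range.2 (Nat.lt_succ_of_le (slopeRank_le _ _)), hvV, (hunit σ hσ).1, (hunit η hη).1,
    slope v, hnot, rfl, r, hr, hpr ▸ hp, by rw [← hpr]; exact hvis, ?_⟩
  rw [← hpr]
  have hpos : 0 < |slope v - x| := abs_pos.2 (sub_ne_zero.2 hxv.symm)
  filter_upwards [Ioo_mem_nhdsGT hpos] with ε hε
  have hd := continuous_dir
  have hc : Continuous fun z : ℝ => (p, dir z) := by fun_prop
  refine cell_chord_eq (q := (p, dir (slope v + η * ε))) (q' := (p, dir x))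
    (T := (fun z : ℝ => (p, dir z)) '' Metric.ball x |slope v - x|)
    ((convex_ball x _).isPreconnected.image _ hc.continuousOn) ?_ ⟨_, ?_, rfl⟩
    ⟨_, Metric.mem_ball_self hpos, rfl⟩
  · rintro _ ⟨z, hz, rfl⟩
    exact hfree z (by simpa [Real.dist_eq] using hz)
  · have h1 : slope v + η * ε - x = η * (ε - |slope v - x|) := by
      rw [← hturn]
      linear_combination (x - slope v) * (hunit η hη).2
    have h2 : |η| = 1 := by
      have := (hunit η hη).2
      rw [← abs_mul_abs_self] at this
      nlinarith [abs_nonneg η]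
    rw [Metric.mem_ball, Real.dist_eq, h1, abs_mul, h2, one_mul, abs_lt]
    constructor <;> linarith [hε.1, hε.2]

lemma encard_patches_le : P.patches.encard ≤
    (P.vertices ×ˢ ({1, -1} : Finset ℝ) ×ˢ ({1, -1} : Finset ℝ) ×ˢ
      Finset.range (P.vertices.card + 1)).card := by
  refine encard_le_of_labels (R := fun (l : Plane × ℝ × ℝ × ℕ) C =>
    P.IsPatchAt l.1 l.2.1 l.2.2.1 l.2.2.2 C) ?_ fun _ _ _ _ _ h h' => h.unique h'
  rintro C ⟨s, hs, hcard, rfl⟩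
  obtain ⟨v, hv, σ, hσ, η, hη, k, hk, h⟩ := exists_isPatchAt hs (encard_eq_zero.1 hcard)
  exact ⟨(v, σ, η, k), Finset.mk_mem_product hv (Finset.mk_mem_product hσ
    (Finset.mk_mem_product hη hk)), h⟩

end PolygonalRegion

/-! ### Adding the three bounds. -/

theorem lemma3p2 :
    ∃ C : ℕ, ∀ P : PolygonalRegion,
      P.maximalSegmentComplexity ≤ (C : ℕ∞) * (P.totalComplexity : ℕ∞) ^ 2 := by
  -- The sum is n² + 3n(n+1) + 4n(n+1) = 8n² + 7n, at most 15n² because n ≤ n².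
  refine ⟨15, fun P => ?_⟩
  refine (add_le_add (add_le_add P.encard_nodes_le P.encard_seams_le)
    P.encard_patches_le).trans ?_
  rw [PolygonalRegion.totalComplexity]
  have h2 : ({1, -1} : Finset ℝ).card ≤ 2 := Finset.card_le_two
  simp only [Finset.card_product, Finset.card_range]
  generalize ({1, -1} : Finset ℝ).card = m at h2
  generalize P.vertices.card = n
  norm_cast
  have hn : n ≤ n * n := Nat.le_mul_self n
  have h4 : m * (m * (n + 1)) ≤ 2 * (2 * (n + 1)) := by gcongr
  nlinarith [Nat.mul_le_mul_left n h4]
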